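/- **Notation.** Let $y_1<\dots<y_n$ be real numbers, $Y=\{y_1,\dots,y_n\}$, and let $\sigma_1,\sigma_3$ be the Pauli matrices. For $m=1,2$ let $H^m(\mathbb R\setminus Y;\mathbb C^2)$ be the space of all $\Psi\in L^2(\mathbb R;\mathbb C^2)$ whose distributional derivatives on $\mathbb R\setminus Y$ up to order $m$ are in $L^2$; $'$ denotes that derivative. Write $\langle f\rangle_a=\frac12(f(a^-)+f(a^+))$ and $[f]_a=f(a^+)-f(a^-)$, and $$\tau_a\Psi=\langle\Psi\rangle_a,\quad \rho_a\Psi=i\sigma_1[\Psi]_a,\quad \hat\tau_a\Psi=(\langle\psi_1\rangle_a,\langle\psi_1'\rangle_a,\langle\psi_2\rangle_a,\langle\psi_2'\rangle_a),\quad \hat\rho_a\Psi=([\psi_1']_a,-[\psi_1]_a,[\psi_2']_a,-[\psi_2]_a)$$ for $\Psi=(\psi_1,\psi_2)$. Put $\tau\Psi=(\tau_{y_k}\Psi)_k\in\mathbb C^{2n}$, $\rho\Psi=(\rho_{y_k}\Psi)_k\in\mathbb C^{2n}$, and let $\hat\tau\Psi,\hat\rho\Psi\in\mathbb C^{2n}\oplus\mathbb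 C^{2n}$ be the vectors whose first (second) summand collects, for $k=1,\dots,n$, the first (last) two entries of $\hat\tau_{y_k}\Psi$, respectively $\hat\rho_{y_k}\Psi$. For an orthogonal projector $\Pi$ in $\mathbb C^{2n}$ and a symmetric $\Theta:\operatorname{ran}\Pi\to\operatorname{ran}\Pi$, let $\mathsf D_{\Pi,\Theta}\Psi=-i\sigma_1\Psi'+\frac12\sigma_3\Psi$ on the domain of all $\Psi\in H^1(\mathbb R\setminus Y;\mathbb C^2)$ with $\rho\Psi\in\operatorname{ran}\Pi$ and $\Pi\tau\Psi=\Theta\rho\Psi$. For an orthogonal projector $\hat\Pi$ in $\mathbb C^{4n}$ and a symmetric $\hat\Theta:\operatorname{ran}\hat\Pi\to\operatorname{ran}\hat\Pi$, let $\hat{\mathsf H}_{\hat\Pi,\hat\Theta}\Psi=-\Psi''$ on the domain of all $\Psi\in H^2(\mathbb R\setminus Y;\mathbb C^2)$ with $\hat\rho\Psi\in\operatorname{ran}\hat\Pi$ and $\hat\Pi\hat\tau\Psi=\hat\Theta\hat\rho\Psi$. Let $U:\mathbb C^{4n}\to\mathbb C^{4n}$, $U(\xi_1,\dots,\xi_{2n})=(\xi_1,\xi_{n+1},\xi_2,\xi_{n+2},\dots,\xi_n,\xi_{2n})$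 with $\xi_k\in\mathbb C^2$, let $$M_1=\begin{bmatrix}1&0&0&0\\0&\frac i2&0&i\\0&1&0&0\\-\frac i2&0&i&0\end{bmatrix},\qquad M_2=\begin{bmatrix}\frac12&0&1&0\\0&i&0&0\\0&-\frac12&0&1\\i&0&0&0\end{bmatrix},$$ and $M_j^\oplus=M_j\oplus\dots\oplus M_j$ ($n$ summands). To the couple $(\Pi,\Theta)$ there corresponds the couple $(\hat\Pi,\hat\Theta)$, where $\hat\Pi$ is the orthogonal projector onto $\operatorname{ran}(U^*M_2^\oplus U(\Pi\oplus\Pi))$ and $$\hat\Theta=\big(A|_{\operatorname{ran}\hat\Pi}\big)^{-1}\,U^*M_2^\oplus U(\Theta\oplus\Theta)U^*(M_2^\oplus)^{-1}U,\qquad A=U^*M_2^\oplus U(\Pi\oplus\Pi)U^*(M_1^\oplus)^{-1}U .$$ An operator $\Theta$ in $\operatorname{ran}\Pi$ is identified with $\Pi\Theta\Pi$ on the whole space where needed. **Statement.** Let $\Pi=\Pi_1\oplus\dots\oplus\Pi_n$ and $\Theta=\Theta_1\oplus\dots\oplus\Theta_n$, with orthogonal projectors $\Pi_k:\mathbb C^2\to\mathbb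 C^2$ and symmetric $\Theta_k:\operatorname{ran}\Pi_k\to\operatorname{ran}\Pi_k$, so that the boundary conditions of $\mathsf D_{\Pi,\Theta}$ are the local ones $\rho_{y_k}\Psi\in\operatorname{ran}\Pi_k$, $\Pi_k\tau_{y_k}\Psi=\Theta_k\rho_{y_k}\Psi$, $1\le k\le n$. Then: 1. $\hat\Pi$ is an orthogonal projector, $\operatorname{ran}A=\operatorname{ran}\hat\Pi$, $A|_{\operatorname{ran}\hat\Pi}$ is a bijection of $\operatorname{ran}\hat\Pi$, $\hat\Theta$ is symmetric, and, as unbounded operators, $(\mathsf D_{\Pi,\Theta})^2=\hat{\mathsf H}_{\hat\Pi,\hat\Theta}+\frac14$. 2. $\hat\Pi=U^*(\hat\Pi_1\oplus\dots\oplus\hat\Pi_n)U$ and $\hat\Theta=U^*(\hat\Theta_1\oplus\dots\oplus\hat\Theta_n)U$, where $\hat\Pi_k$ is the orthogonal projector in $\mathbb C^4$ onto $\operatorname{ran}(M_2(\Pi_k\oplus\Pi_k)M_1^{-1})$, of dimension $2\dim\operatorname{ran}\Pi_k$, and $\hat\Theta_k=\hat\Pi_kM_1(\Theta_k\oplus\Theta_k)M_2^{-1}$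 is a symmetric operator in $\operatorname{ran}\hat\Pi_k$. 3. If $\Pi_k=\mathbb 1$, then $\hat\Pi_k=\mathbb 1$ and $\hat\Theta_k=M_1(\Theta_k\oplus\Theta_k)M_2^{-1}$. If $\Pi_k\ne\mathbb 1$, then $\Theta_k$ is the multiplication by some $\theta_k\in\mathbb R$, $\hat\Theta_k=\theta_k\,\hat\Pi_kM_1(\Pi_k\oplus\Pi_k)M_2^{-1}$ on $\operatorname{ran}\hat\Pi_k$, and $\dim\operatorname{ran}\hat\Pi_k=2$ unless $\Pi_k=0$. 4. The boundary conditions of $\hat{\mathsf H}_{\hat\Pi,\hat\Theta}$ are local: $\Psi$ is in its domain if and only if $\Psi\in H^2(\mathbb R\setminus Y;\mathbb C^2)$ and $$\hat\rho_{y_k}\Psi\in\operatorname{ran}\hat\Pi_k,\qquad \hat\Pi_k\hat\tau_{y_k}\Psi=\hat\Theta_k\hat\rho_{y_k}\Psi,\qquad 1\le k\le n .$$ -/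

import Mathlib

open MeasureTheory Filter Topology
open scoped ContDiff Matrix

noncomputable section

namespace DiracPoint

section
variable {E : Type*} [NormedAddCommGroup E] [NormedSpace ℝ E] [CompleteSpace E]

theorem primitive_ibp {a b : ℝ} {g : ℝ → E} (hg : LocallyIntegrable g volume)
    {φ : ℝ → ℝ} (h1 : ContDiff ℝ ∞ φ) (h3 : tsupport φ ⊆ Set.Ioo a b) :
    ∫ x, deriv φ x • (∫ t in a..x, g t) = - ∫ x, φ x • g x := by
  have hd : ∀ x, HasDerivAt φ (deriv φ x) x := fun x =>
    (h1.differentiable (by simp) x).hasDerivAt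
  have hdc : Continuous (deriv φ) := h1.continuous_deriv (by simp)
  have z1 : ∀ x, x ∉ Set.Ioc a b → φ x = 0 := fun x hx =>
    image_eq_zero_of_notMem_tsupport fun h => hx (Set.Ioo_subset_Ioc_self (h3 h))
  have z2 : ∀ x, x ∉ Set.Ioc a b → deriv φ x = 0 := fun x hx =>
    image_eq_zero_of_notMem_tsupport fun h => hx (Set.Ioo_subset_Ioc_self (h3
      (closure_minimal (support_deriv_subset) (isClosed_tsupport _) h)))
  have hgi : IntegrableOn g (Set.Ioc a b) :=
    (hg.integrableOn_isCompact isCompact_Icc).mono_set Set.Ioc_subset_Icc_self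
  have hdi : IntegrableOn (deriv φ) (Set.Ioc a b) :=
    (hdc.integrableOn_Icc).mono_set Set.Ioc_subset_Icc_self
  have e1 : ∫ x, deriv φ x • (∫ t in a..x, g t) =
      ∫ x in Set.Ioc a b, ∫ t in Set.Ioc a b,
        (Set.Ici t).indicator (fun _ => deriv φ x • g t) x := by
    rw [← setIntegral_eq_integral_of_forall_compl_eq_zero (s := Set.Ioc a b)
      (fun x hx => by rw [z2 x hx, zero_smul])]
    refine setIntegral_congr_fun measurableSet_Ioc fun x hx => ?_
    have : ∀ t, (Set.Ici t).indicator (fun _ => deriv φ x • g t) x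
        = (Set.Iic x).indicator (fun t => deriv φ x • g t) t := by
      intro t; simp [Set.indicator_apply]
    simp only [this]
    rw [setIntegral_indicator measurableSet_Iic, integral_smul,
      intervalIntegral.integral_of_le hx.1.le]
    congr 3
    ext t; simp only [Set.mem_inter_iff, Set.mem_Ioc, Set.mem_Iic]
    constructor
    · rintro ⟨h, h'⟩; exact ⟨⟨h, h'.trans hx.2⟩, h'⟩
    · rintro ⟨⟨h, _⟩, h'⟩; exact ⟨h, h'⟩
  rw [e1, integral_integral_swap]
  · rw [← setIntegral_eq_integral_of_forall_compl_eq_zero (s := Set.Ioc a b)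
      (f := fun x => φ x • g x) (fun x hx => by rw [z1 x hx, zero_smul]), ← integral_neg]
    refine setIntegral_congr_fun measurableSet_Ioc fun t ht => ?_
    have hi : ∀ x, (Set.Ici t).indicator (fun _ => deriv φ x • g t) x
        = (Set.Ici t).indicator (fun x => deriv φ x • g t) x := fun x => by
      simp [Set.indicator_apply]
    simp only [hi]
    rw [setIntegral_indicator measurableSet_Ici, integral_smul_const, ← neg_smul]
    congr 1
    have hs : (Set.Ioc a b ∩ Set.Ici t) = Set.Icc t b := by
      ext x; simp only [Set.mem_inter_iff, Set.mem_Ioc, Set.mem_Ici, Set.mem_Icc]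
      constructor
      · rintro ⟨h, h'⟩; exact ⟨h', h.2⟩
      · rintro ⟨h, h'⟩; exact ⟨⟨ht.1.trans_le h, h'⟩, h⟩
    rw [hs, integral_Icc_eq_integral_Ioc, ← intervalIntegral.integral_of_le ht.2,
      intervalIntegral.integral_deriv_eq_sub (fun x _ => (hd x).differentiableAt)
      (hdc.intervalIntegrable _ _)]
    have : φ b = 0 := image_eq_zero_of_notMem_tsupport fun h => lt_irrefl _ (h3 h).2
    rw [this, zero_sub]
  · have : Integrable (fun p : ℝ × ℝ => deriv φ p.1 • g p.2)
        ((volume.restrict (Set.Ioc a b)).prod (volume.restrict (Set.Ioc a b))) :=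
      hdi.smul_prod hgi
    have h := this.indicator (s := {p : ℝ × ℝ | p.2 ≤ p.1})
      (measurableSet_le measurable_snd measurable_fst)
    refine h.congr (Eventually.of_forall fun p => ?_)
    simp [Set.indicator_apply, Function.uncurry]

theorem du_bois_reymond {a b : ℝ} (hab : a < b) {f g : ℝ → E} (hf : LocallyIntegrable f volume)
    (hg : LocallyIntegrable g volume)
    (h : ∀ φ : ℝ → ℝ, ContDiff ℝ ∞ φ → HasCompactSupport φ → tsupport φ ⊆ Set.Ioo a b →
      ∫ x, deriv φ x • f x = - ∫ x, φ x • g x) :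
    ∃ c : E, ∀ᵐ x, x ∈ Set.Ioo a b → f x = c + ∫ t in a..x, g t := by
  set F : ℝ → E := fun x => ∫ t in a..x, g t with hF
  have hFc : Continuous F := intervalIntegral.continuous_primitive
    (fun u v => (hg.integrableOn_isCompact isCompact_uIcc).intervalIntegrable) a
  have hFl : LocallyIntegrable F volume := hFc.locallyIntegrable
  have hfF := hf.sub hFl
  have h0 : ∀ φ : ℝ → ℝ, ContDiff ℝ ∞ φ → HasCompactSupport φ → tsupport φ ⊆ Set.Ioo a b →
      ∫ x, deriv φ x • (f - F) x = 0 := by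
    intro φ h1 h2 h3
    have hc := h1.continuous_deriv (n := ∞) (by simp)
    simp only [Pi.sub_apply, smul_sub]
    rw [integral_sub (hf.integrable_smul_left_of_hasCompactSupport hc h2.deriv)
      (hFl.integrable_smul_left_of_hasCompactSupport hc h2.deriv), h φ h1 h2 h3, hF,
      primitive_ibp hg h1 h3, sub_self]
  let B : ContDiffBump ((a + b) / 2) := ⟨(b - a) / 8, (b - a) / 4, by linarith, by linarith⟩
  let φ₀ : ℝ → ℝ := B.normed volume
  have b1 : ContDiff ℝ ∞ φ₀ := B.contDiff_normed
  have b2 : HasCompactSupport φ₀ := B.hasCompactSupport_normed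
  have b3 : tsupport φ₀ ⊆ Set.Ioo a b := by
    rw [B.tsupport_normed_eq, Real.closedBall_eq_Icc]
    intro x hx
    have e : B.rOut = (b - a) / 4 := rfl
    rw [e] at hx
    constructor <;> linarith [hx.1, hx.2]
  have b4 : ∫ x, φ₀ x = 1 := B.integral_normed
  refine ⟨∫ x, φ₀ x • (f - F) x, ?_⟩
  set c := ∫ x, φ₀ x • (f - F) x with hc
  have key : ∀ᵐ x, x ∈ Set.Ioo a b → f x - F x - c = 0 := by
    apply isOpen_Ioo.ae_eq_zero_of_integral_contDiff_smul_eq_zero (f := fun x => f x - F x - c)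
    · exact (hfF.sub (locallyIntegrable_const c)).locallyIntegrableOn _
    · intro φ h1 h2 h3
      set m := ∫ x, φ x with hm
      set χ : ℝ → ℝ := fun x => φ x - m * φ₀ x with hχ
      have c1 : ContDiff ℝ ∞ χ := h1.sub (contDiff_const.mul b1)
      have c0 : Continuous χ := c1.continuous
      obtain ⟨a', b', ha', hb', hab', hs⟩ : ∃ a' b', a < a' ∧ b' < b ∧ a' ≤ b' ∧
          ∀ x, x ∉ Set.Icc a' b' → χ x = 0 := by
        let K := (tsupport φ ∪ tsupport φ₀) ∪ {(a + b) / 2}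
        have K1 : IsCompact K := (h2.isCompact.union b2.isCompact).union isCompact_singleton
        have K2 : K.Nonempty := ⟨(a + b) / 2, by simp [K]⟩
        have K3 : K ⊆ Set.Ioo a b := Set.union_subset (Set.union_subset h3 b3) (by
          simp only [Set.singleton_subset_iff, Set.mem_Ioo]; constructor <;> linarith)
        refine ⟨sInf K, sSup K, (K3 (K1.sInf_mem K2)).1, (K3 (K1.sSup_mem K2)).2,
          csInf_le_csSup K2 K1.bddBelow K1.bddAbove, fun x hx => ?_⟩
        have hxK : x ∉ K := fun hk => hx ⟨csInf_le K1.bddBelow hk, le_csSup K1.bddAbove hk⟩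
        simp only [K, Set.mem_union, not_or] at hxK
        simp [hχ, image_eq_zero_of_notMem_tsupport hxK.1.1,
          image_eq_zero_of_notMem_tsupport hxK.1.2]
      have iφ : Integrable φ := h1.continuous.integrable_of_hasCompactSupport h2
      have iφ₀ : Integrable φ₀ := b1.continuous.integrable_of_hasCompactSupport b2
      have c2 : ∫ x, χ x = 0 := by
        rw [hχ, integral_sub iφ (iφ₀.const_mul m), integral_const_mul, b4, mul_one, sub_self]
      set ψ : ℝ → ℝ := fun x => ∫ t in a'..x, χ t with hψ
      have d1 : ∀ x, HasDerivAt ψ (χ x) x := fun x =>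
        intervalIntegral.integral_hasDerivAt_right (c0.intervalIntegrable _ _)
          (c0.stronglyMeasurableAtFilter _ _) c0.continuousAt
      have d2 : deriv ψ = χ := funext fun x => (d1 x).deriv
      have d3 : ContDiff ℝ ∞ ψ := by
        rw [contDiff_infty_iff_deriv, d2]
        exact ⟨fun x => (d1 x).differentiableAt, c1⟩
      have d4 : Function.support ψ ⊆ Set.Icc a' b' := by
        intro x hx
        by_contra hn
        apply hx
        rcases lt_or_ge x a' with hlt | hge
        · simp only [hψ]
          rw [intervalIntegral.integral_symm, neg_eq_zero]
          apply intervalIntegral.integral_zero_ae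
          have : ∀ᵐ t : ℝ, t ≠ a' := by simp [ae_iff]
          filter_upwards [this] with t ht ht'
          rw [Set.uIoc_of_le hlt.le] at ht'
          exact hs t fun h => ht (le_antisymm ht'.2 h.1)
        · have hb : b' < x := by by_contra hh; exact hn ⟨hge, not_lt.1 hh⟩
          simp only [hψ]
          rw [intervalIntegral.integral_of_le hge, ← integral_Icc_eq_integral_Ioc, ← c2]
          exact setIntegral_eq_integral_of_forall_compl_eq_zero fun t ht =>
            hs t fun h => ht ⟨h.1, h.2.trans hb.le⟩
      have d5 : tsupport ψ ⊆ Set.Icc a' b' := closure_minimal d4 isClosed_Icc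
      have d6 : HasCompactSupport ψ :=
        HasCompactSupport.of_support_subset_isCompact isCompact_Icc d4
      have h00 := h0 ψ d3 d6 (d5.trans fun x hx => ⟨ha'.trans_le hx.1, hx.2.trans_lt hb'⟩)
      have j1 := hfF.integrable_smul_left_of_hasCompactSupport h1.continuous h2
      have j2 := hfF.integrable_smul_left_of_hasCompactSupport b1.continuous b2
      rw [d2] at h00
      simp only [hχ, sub_smul, mul_smul] at h00
      have j3 : Integrable (fun x => m • φ₀ x • (f - F) x) volume := j2.smul m
      rw [integral_sub j1 j3, integral_smul, ← hc] at h00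
      have e : ∀ x, φ x • (f x - F x - c) = φ x • (f - F) x - φ x • c := fun x => by
        rw [← smul_sub]; rfl
      simp only [e]
      rw [integral_sub j1 (iφ.smul_const c), integral_smul_const, ← hm, h00]
  filter_upwards [key] with x hx hxm
  have := hx hxm
  rw [sub_sub, sub_eq_zero] at this
  rw [this, add_comm]
end


/-- `ℂ²` with its Euclidean inner product. -/
abbrev C2 := EuclideanSpace ℂ (Fin 2)

/-- `L²(ℝ; ℂ²)`. -/
abbrev L2 : Type := Lp C2 2 (volume : Measure ℝ)

/-- `g` is the distributional derivative of `f` on the open set `ℝ \ {y₁, …, yₙ}`. -/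
def IsWeakDeriv {n : ℕ} (y : Fin n → ℝ) (f g : L2) : Prop :=
  ∀ φ : ℝ → ℝ, ContDiff ℝ ∞ φ → HasCompactSupport φ → tsupport φ ⊆ (Set.range y)ᶜ →
    ∫ x, deriv φ x • f x = - ∫ x, φ x • g x

section WeakDerivFacts

variable {n : ℕ} {y : Fin n → ℝ} {f g f' g' : L2}

theorem locInt (f : L2) : LocallyIntegrable f volume :=
  (Lp.memLp f).locallyIntegrable (by norm_num)

theorem IsWeakDeriv.unique (h : IsWeakDeriv y f g) (h' : IsWeakDeriv y f g') : g = g' := by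
  have hfin : (Set.range y).Finite := Set.finite_range y
  have key := hfin.isClosed.isOpen_compl.ae_eq_zero_of_integral_contDiff_smul_eq_zero
    (f := fun x => g x - g' x) (((locInt g).sub (locInt g')).locallyIntegrableOn _)
    (μ := volume) (fun φ h1 h2 h3 => by
      simp only [smul_sub]
      rw [integral_sub ((locInt g).integrable_smul_left_of_hasCompactSupport h1.continuous h2)
        ((locInt g').integrable_smul_left_of_hasCompactSupport h1.continuous h2), sub_eq_zero]
      exact neg_injective ((h φ h1 h2 h3).symm.trans (h' φ h1 h2 h3)))
  have hn : ∀ᵐ x : ℝ, x ∈ (Set.range y)ᶜ :=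
    compl_mem_ae_iff.2 (hfin.measure_zero volume)
  apply Lp.ext
  filter_upwards [key, hn] with x hx hx'
  exact sub_eq_zero.1 (hx hx')

theorem IsWeakDeriv.zero : IsWeakDeriv y 0 0 := by
  intro φ h1 h2 h3
  have h0 : ∀ᵐ x : ℝ, (0 : L2) x = 0 := Lp.coeFn_zero C2 2 volume
  rw [integral_eq_zero_of_ae, integral_eq_zero_of_ae, neg_zero]
  · filter_upwards [h0] with x hx; simp only [hx, smul_zero, Pi.zero_apply]
  · filter_upwards [h0] with x hx; simp only [hx, smul_zero, Pi.zero_apply]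

theorem IsWeakDeriv.add (h : IsWeakDeriv y f g) (h' : IsWeakDeriv y f' g') :
    IsWeakDeriv y (f + f') (g + g') := by
  intro φ h1 h2 h3
  have hc := h1.continuous_deriv (n := ∞) (by simp)
  have e1 : ∫ x, deriv φ x • (f + f' : L2) x
      = ∫ x, deriv φ x • f x + deriv φ x • f' x := integral_congr_ae (by
    filter_upwards [Lp.coeFn_add f f'] with x hx; rw [hx, Pi.add_apply, smul_add])
  have e2 : ∫ x, φ x • (g + g' : L2) x = ∫ x, φ x • g x + φ x • g' x := integral_congr_ae (by
    filter_upwards [Lp.coeFn_add g g'] with x hx; rw [hx, Pi.add_apply, smul_add])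
  rw [e1, e2, integral_add ((locInt f).integrable_smul_left_of_hasCompactSupport hc h2.deriv)
    ((locInt f').integrable_smul_left_of_hasCompactSupport hc h2.deriv),
    integral_add ((locInt g).integrable_smul_left_of_hasCompactSupport h1.continuous h2)
    ((locInt g').integrable_smul_left_of_hasCompactSupport h1.continuous h2),
    h φ h1 h2 h3, h' φ h1 h2 h3, neg_add]

theorem IsWeakDeriv.smul (c : ℂ) (h : IsWeakDeriv y f g) : IsWeakDeriv y (c • f) (c • g) := by
  intro φ h1 h2 h3
  have e1 : ∫ x, deriv φ x • (c • f : L2) x = ∫ x, c • deriv φ x • f x := integral_congr_ae (by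
    filter_upwards [Lp.coeFn_smul c f] with x hx; rw [hx, Pi.smul_apply, smul_comm])
  have e2 : ∫ x, φ x • (c • g : L2) x = ∫ x, c • φ x • g x := integral_congr_ae (by
    filter_upwards [Lp.coeFn_smul c g] with x hx; rw [hx, Pi.smul_apply, smul_comm])
  rw [e1, e2, integral_smul, integral_smul, h φ h1 h2 h3, smul_neg]

end WeakDerivFacts

/-- The Sobolev space `H¹(ℝ \ {y₁, …, yₙ}; ℂ²)`. -/
def H1 {n : ℕ} (y : Fin n → ℝ) : Submodule ℂ L2 where
  carrier := {f | ∃ g, IsWeakDeriv y f g}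
  zero_mem' := ⟨0, IsWeakDeriv.zero⟩
  add_mem' := fun ⟨_, h⟩ ⟨_, h'⟩ => ⟨_, h.add h'⟩
  smul_mem' := fun c _ ⟨_, h⟩ => ⟨_, h.smul c⟩

open Classical in
/-- The distributional derivative on `ℝ \ {y₁, …, yₙ}` of an element of `H¹(ℝ \ {y₁, …, yₙ}; ℂ²)`
(and `0` outside that space). -/
def wderiv {n : ℕ} (y : Fin n → ℝ) (f : L2) : L2 :=
  if h : ∃ g, IsWeakDeriv y f g then h.choose else 0

theorem wderiv_spec {n : ℕ} {y : Fin n → ℝ} {f : L2} (h : f ∈ H1 y) :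
    IsWeakDeriv y f (wderiv y f) := by
  have h' : ∃ g, IsWeakDeriv y f g := h
  rw [wderiv, dif_pos h']
  exact h'.choose_spec

theorem wderiv_eq {n : ℕ} {y : Fin n → ℝ} {f g : L2} (h : IsWeakDeriv y f g) :
    wderiv y f = g := (wderiv_spec (y := y) ⟨g, h⟩).unique h

theorem wderiv_zero {n : ℕ} (y : Fin n → ℝ) : wderiv y 0 = 0 := wderiv_eq IsWeakDeriv.zero

theorem wderiv_add {n : ℕ} {y : Fin n → ℝ} {f g : L2} (hf : f ∈ H1 y) (hg : g ∈ H1 y) :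
    wderiv y (f + g) = wderiv y f + wderiv y g :=
  wderiv_eq ((wderiv_spec hf).add (wderiv_spec hg))

theorem wderiv_smul {n : ℕ} {y : Fin n → ℝ} {f : L2} (c : ℂ) (hf : f ∈ H1 y) :
    wderiv y (c • f) = c • wderiv y f :=
  wderiv_eq ((wderiv_spec hf).smul c)

/-- The Sobolev space `H²(ℝ \ {y₁, …, yₙ}; ℂ²)`. -/
def H2 {n : ℕ} (y : Fin n → ℝ) : Submodule ℂ L2 where
  carrier := {f | f ∈ H1 y ∧ wderiv y f ∈ H1 y}
  zero_mem' := ⟨zero_mem _, by rw [wderiv_zero]; exact zero_mem _⟩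
  add_mem' := fun ⟨h, h'⟩ ⟨k, k'⟩ =>
    ⟨add_mem h k, by rw [wderiv_add h k]; exact add_mem h' k'⟩
  smul_mem' := fun c _ ⟨h, h'⟩ =>
    ⟨Submodule.smul_mem _ c h, by rw [wderiv_smul c h]; exact Submodule.smul_mem _ c h'⟩

/-- The left limit `f(a⁻)` of a class of functions modulo null sets: the limit as `x → a`, `x < a`,
off a null set. -/
def leftLim (f : L2) (a : ℝ) : C2 := limUnder (𝓝[<] a ⊓ ae volume) (f : ℝ → C2)

/-- The right limit `f(a⁺)`, likewise. -/
def rightLim (f : L2) (a : ℝ) : C2 := limUnder (𝓝[>] a ⊓ ae volume) (f : ℝ → C2)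

section LimitFacts

instance neBot_left (a : ℝ) : (𝓝[<] a ⊓ ae (volume : Measure ℝ)).NeBot := by
  rw [inf_neBot_iff]
  intro s hs t ht
  obtain ⟨l, hl, hls⟩ := (mem_nhdsLT_iff_exists_Ioo_subset).1 hs
  by_contra hne
  rw [Set.not_nonempty_iff_eq_empty] at hne
  have hsub : Set.Ioo l a ⊆ tᶜ := fun x hx hxt =>
    Set.notMem_empty x (hne ▸ ⟨hls hx, hxt⟩)
  have h0 := measure_mono_null hsub (mem_ae_iff.1 ht)
  rw [Real.volume_Ioo, ENNReal.ofReal_eq_zero] at h0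
  have : l < a := hl
  linarith

instance neBot_right (a : ℝ) : (𝓝[>] a ⊓ ae (volume : Measure ℝ)).NeBot := by
  rw [inf_neBot_iff]
  intro s hs t ht
  obtain ⟨l, hl, hls⟩ := (mem_nhdsGT_iff_exists_Ioo_subset).1 hs
  by_contra hne
  rw [Set.not_nonempty_iff_eq_empty] at hne
  have hsub : Set.Ioo a l ⊆ tᶜ := fun x hx hxt =>
    Set.notMem_empty x (hne ▸ ⟨hls hx, hxt⟩)
  have h0 := measure_mono_null hsub (mem_ae_iff.1 ht)
  rw [Real.volume_Ioo, ENNReal.ofReal_eq_zero] at h0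
  have : a < l := hl
  linarith

theorem exists_limits {n : ℕ} {y : Fin n → ℝ} {f : L2} (hf : f ∈ H1 y) (a : ℝ) :
    (∃ c, Tendsto (f : ℝ → C2) (𝓝[<] a ⊓ ae volume) (𝓝 c)) ∧
      ∃ c, Tendsto (f : ℝ → C2) (𝓝[>] a ⊓ ae volume) (𝓝 c) := by
  obtain ⟨g, hg⟩ := hf
  have hcl : IsClosed (Set.range y \ {a}) := ((Set.finite_range y).sdiff).isClosed
  obtain ⟨ε, hε, hb⟩ := Metric.isOpen_iff.1 hcl.isOpen_compl a (by simp)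
  rw [Real.ball_eq_Ioo] at hb
  have main : ∀ l r : ℝ, l < r → Set.Ioo l r ⊆ Set.Ioo (a - ε) (a + ε) → a ∉ Set.Ioo l r →
      ∃ c : C2, ∀ᵐ x, x ∈ Set.Ioo l r → f x = c + ∫ t in l..x, g t := by
    intro l r hlr hsub ha
    refine du_bois_reymond hlr (locInt f) (locInt g) fun φ h1 h2 h3 => hg φ h1 h2 fun x hx hxy => ?_
    exact hb (hsub (h3 hx)) ⟨hxy, fun hxa => ha (hxa ▸ h3 hx)⟩
  have cont : ∀ (l : ℝ) (c : C2), Tendsto (fun x => c + ∫ t in l..x, g t) (𝓝 a)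
      (𝓝 (c + ∫ t in l..a, g t)) := fun l c =>
    (continuous_const.add (intervalIntegral.continuous_primitive (fun u v =>
      ((locInt g).integrableOn_isCompact isCompact_uIcc).intervalIntegrable) l)).tendsto a
  constructor
  · obtain ⟨c, hc⟩ := main (a - ε) a (by linarith) (Set.Ioo_subset_Ioo_right (by linarith))
      (fun h => lt_irrefl _ h.2)
    refine ⟨_, ((cont (a - ε) c).mono_left (inf_le_left.trans nhdsWithin_le_nhds)).congr' ?_⟩
    have h1 : ∀ᶠ x in 𝓝[<] a ⊓ ae volume, x ∈ Set.Ioo (a - ε) a :=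
      mem_inf_of_left (Ioo_mem_nhdsLT (by linarith))
    have h2 : ∀ᶠ x in 𝓝[<] a ⊓ ae volume, x ∈ Set.Ioo (a - ε) a →
      f x = c + ∫ t in (a - ε)..x, g t := mem_inf_of_right hc
    filter_upwards [h1, h2] with x hx hx'
    exact (hx' hx).symm
  · obtain ⟨c, hc⟩ := main a (a + ε) (by linarith) (Set.Ioo_subset_Ioo_left (by linarith))
      (fun h => lt_irrefl _ h.1)
    refine ⟨_, ((cont a c).mono_left (inf_le_left.trans nhdsWithin_le_nhds)).congr' ?_⟩
    have h1 : ∀ᶠ x in 𝓝[>] a ⊓ ae volume, x ∈ Set.Ioo a (a + ε) :=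
      mem_inf_of_left (Ioo_mem_nhdsGT (by linarith))
    have h2 : ∀ᶠ x in 𝓝[>] a ⊓ ae volume, x ∈ Set.Ioo a (a + ε) →
      f x = c + ∫ t in a..x, g t := mem_inf_of_right hc
    filter_upwards [h1, h2] with x hx hx'
    exact (hx' hx).symm

variable {n : ℕ} {y : Fin n → ℝ} {f g : L2}

theorem tendsto_leftLim (hf : f ∈ H1 y) (a : ℝ) :
    Tendsto (f : ℝ → C2) (𝓝[<] a ⊓ ae volume) (𝓝 (leftLim f a)) :=
  tendsto_nhds_limUnder (exists_limits hf a).1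

theorem tendsto_rightLim (hf : f ∈ H1 y) (a : ℝ) :
    Tendsto (f : ℝ → C2) (𝓝[>] a ⊓ ae volume) (𝓝 (rightLim f a)) :=
  tendsto_nhds_limUnder (exists_limits hf a).2

theorem leftLim_zero (a : ℝ) : leftLim 0 a = 0 :=
  Tendsto.limUnder_eq (tendsto_const_nhds.congr'
    (((Lp.coeFn_zero C2 2 volume).filter_mono inf_le_right).mono fun _ h => h.symm))

theorem rightLim_zero (a : ℝ) : rightLim 0 a = 0 :=
  Tendsto.limUnder_eq (tendsto_const_nhds.congr'
    (((Lp.coeFn_zero C2 2 volume).filter_mono inf_le_right).mono fun _ h => h.symm))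

theorem leftLim_add (hf : f ∈ H1 y) (hg : g ∈ H1 y) (a : ℝ) :
    leftLim (f + g) a = leftLim f a + leftLim g a :=
  Tendsto.limUnder_eq (((tendsto_leftLim hf a).add (tendsto_leftLim hg a)).congr'
    (((Lp.coeFn_add f g).filter_mono inf_le_right).mono fun _ h => h.symm))

theorem rightLim_add (hf : f ∈ H1 y) (hg : g ∈ H1 y) (a : ℝ) :
    rightLim (f + g) a = rightLim f a + rightLim g a :=
  Tendsto.limUnder_eq (((tendsto_rightLim hf a).add (tendsto_rightLim hg a)).congr'
    (((Lp.coeFn_add f g).filter_mono inf_le_right).mono fun _ h => h.symm))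

theorem leftLim_smul (c : ℂ) (hf : f ∈ H1 y) (a : ℝ) :
    leftLim (c • f) a = c • leftLim f a :=
  Tendsto.limUnder_eq (((tendsto_leftLim hf a).const_smul c).congr'
    (((Lp.coeFn_smul c f).filter_mono inf_le_right).mono fun _ h => h.symm))

theorem rightLim_smul (c : ℂ) (hf : f ∈ H1 y) (a : ℝ) :
    rightLim (c • f) a = c • rightLim f a :=
  Tendsto.limUnder_eq (((tendsto_rightLim hf a).const_smul c).congr'
    (((Lp.coeFn_smul c f).filter_mono inf_le_right).mono fun _ h => h.symm))

end LimitFacts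

/-- The mean value `⟨f⟩_a = (f(a⁻) + f(a⁺)) / 2`. -/
def mean (f : L2) (a : ℝ) : C2 := (1 / 2 : ℂ) • (leftLim f a + rightLim f a)

/-- The jump `[f]_a = f(a⁺) - f(a⁻)`. -/
def jump (f : L2) (a : ℝ) : C2 := rightLim f a - leftLim f a

section TraceFacts

variable {n : ℕ} {y : Fin n → ℝ} {f g : L2}

theorem mean_zero (a : ℝ) : mean 0 a = 0 := by simp [mean, leftLim_zero, rightLim_zero]

theorem jump_zero (a : ℝ) : jump 0 a = 0 := by simp [jump, leftLim_zero, rightLim_zero]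

theorem mean_add (hf : f ∈ H1 y) (hg : g ∈ H1 y) (a : ℝ) :
    mean (f + g) a = mean f a + mean g a := by
  rw [mean, mean, mean, leftLim_add hf hg, rightLim_add hf hg]; module

theorem jump_add (hf : f ∈ H1 y) (hg : g ∈ H1 y) (a : ℝ) :
    jump (f + g) a = jump f a + jump g a := by
  rw [jump, jump, jump, leftLim_add hf hg, rightLim_add hf hg]; module

theorem mean_smul (c : ℂ) (hf : f ∈ H1 y) (a : ℝ) : mean (c • f) a = c • mean f a := by
  rw [mean, mean, leftLim_smul c hf, rightLim_smul c hf]; module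

theorem jump_smul (c : ℂ) (hf : f ∈ H1 y) (a : ℝ) : jump (c • f) a = c • jump f a := by
  rw [jump, jump, leftLim_smul c hf, rightLim_smul c hf]; module

end TraceFacts

/-- The Pauli matrix `σ₁`. -/
def sigma1 : Matrix (Fin 2) (Fin 2) ℂ := !![0, 1; 1, 0]

/-- The Pauli matrix `σ₃`. -/
def sigma3 : Matrix (Fin 2) (Fin 2) ℂ := !![1, 0; 0, -1]

/-- The pointwise action of a constant `2 × 2` matrix on `L²(ℝ; ℂ²)`. -/
def act (A : Matrix (Fin 2) (Fin 2) ℂ) : L2 →ₗ[ℂ] L2 :=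
  ((Matrix.toEuclideanCLM (n := Fin 2) (𝕜 := ℂ) A).compLpL 2 volume : L2 →L[ℂ] L2)

/-- `ℂ²ⁿ`, as `n`-tuples of vectors of `ℂ²`: the coordinate `(j, k)` is the `j`-th component of the
`k`-th vector. -/
abbrev C2n (n : ℕ) := EuclideanSpace ℂ (Fin 2 × Fin n)

/-- `ℂ⁴ⁿ = ℂ²ⁿ ⊕ ℂ²ⁿ`. -/
abbrev C4n (n : ℕ) := EuclideanSpace ℂ ((Fin 2 × Fin n) ⊕ (Fin 2 × Fin n))

/-- `ℂ⁴ = ℂ² ⊕ ℂ²`. -/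
abbrev C4 := EuclideanSpace ℂ (Fin 2 ⊕ Fin 2)

/-- `τ_a Ψ = ⟨Ψ⟩_a`. -/
def tauAt (a : ℝ) (Ψ : L2) : C2 := mean Ψ a

/-- `ρ_a Ψ = i σ₁ [Ψ]_a`. -/
def rhoAt (a : ℝ) (Ψ : L2) : C2 := Complex.I • Matrix.toEuclideanLin sigma1 (jump Ψ a)

/-- `τ Ψ = (τ_{y₁} Ψ, …, τ_{yₙ} Ψ)`. -/
def tau {n : ℕ} (y : Fin n → ℝ) (Ψ : L2) : C2n n :=
  WithLp.toLp 2 fun s => tauAt (y s.2) Ψ s.1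

/-- `ρ Ψ = (ρ_{y₁} Ψ, …, ρ_{yₙ} Ψ)`. -/
def rho {n : ℕ} (y : Fin n → ℝ) (Ψ : L2) : C2n n :=
  WithLp.toLp 2 fun s => rhoAt (y s.2) Ψ s.1

/-- `τ̂_a ψ_j = ⟨ψ_j⟩_a ⊕ ⟨ψ_j'⟩_a` for the `j`-th component `ψ_j` of `Ψ`. -/
def tauHatComp {n : ℕ} (y : Fin n → ℝ) (a : ℝ) (Ψ : L2) (j : Fin 2) : Fin 2 → ℂ :=
  ![mean Ψ a j, mean (wderiv y Ψ) a j]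

/-- `ρ̂_a ψ_j = [ψ_j']_a ⊕ [-ψ_j]_a` for the `j`-th component `ψ_j` of `Ψ`. -/
def rhoHatComp {n : ℕ} (y : Fin n → ℝ) (a : ℝ) (Ψ : L2) (j : Fin 2) : Fin 2 → ℂ :=
  ![jump (wderiv y Ψ) a j, -jump Ψ a j]

/-- `(τ̂_a 𝟙) Ψ = τ̂_a ψ₁ ⊕ τ̂_a ψ₂`. -/
def tauHatAt {n : ℕ} (y : Fin n → ℝ) (a : ℝ) (Ψ : L2) : C4 :=
  WithLp.toLp 2 (Sum.elim (tauHatComp y a Ψ 0) (tauHatComp y a Ψ 1))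

/-- `(ρ̂_a 𝟙) Ψ = ρ̂_a ψ₁ ⊕ ρ̂_a ψ₂`. -/
def rhoHatAt {n : ℕ} (y : Fin n → ℝ) (a : ℝ) (Ψ : L2) : C4 :=
  WithLp.toLp 2 (Sum.elim (rhoHatComp y a Ψ 0) (rhoHatComp y a Ψ 1))

/-- `(τ̂ 𝟙) Ψ = τ̂ ψ₁ ⊕ τ̂ ψ₂` with `τ̂ ψ = (τ̂_{y₁} ψ, …, τ̂_{yₙ} ψ)`. -/
def tauHat {n : ℕ} (y : Fin n → ℝ) (Ψ : L2) : C4n n :=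
  WithLp.toLp 2 (Sum.elim (fun s => tauHatComp y (y s.2) Ψ 0 s.1)
    (fun s => tauHatComp y (y s.2) Ψ 1 s.1))

/-- `(ρ̂ 𝟙) Ψ = ρ̂ ψ₁ ⊕ ρ̂ ψ₂` with `ρ̂ ψ = (ρ̂_{y₁} ψ, …, ρ̂_{yₙ} ψ)`. -/
def rhoHat {n : ℕ} (y : Fin n → ℝ) (Ψ : L2) : C4n n :=
  WithLp.toLp 2 (Sum.elim (fun s => rhoHatComp y (y s.2) Ψ 0 s.1)
    (fun s => rhoHatComp y (y s.2) Ψ 1 s.1))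

section Param

variable {ι : Type*} [Fintype ι] [DecidableEq ι]

/-- The range of a square matrix, as a subspace of the Euclidean space it acts on. -/
abbrev ran (P : Matrix ι ι ℂ) : Submodule ℂ (EuclideanSpace ℂ ι) :=
  LinearMap.range (Matrix.toEuclideanLin P)

/-- The boundary condition `r ∈ ran P`, `P t = Θ r` on a pair of vectors `r, t`. -/
def BC (P : Matrix ι ι ℂ) (Θ : ran P →ₗ[ℂ] ran P) (r t : EuclideanSpace ℂ ι) : Prop :=
  ∃ h : r ∈ ran P, Matrix.toEuclideanLin P t = (Θ ⟨r, h⟩ : EuclideanSpace ℂ ι)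

theorem BC.zero (P : Matrix ι ι ℂ) (Θ : ran P →ₗ[ℂ] ran P) : BC P Θ 0 0 :=
  ⟨zero_mem _, by
    have : (⟨0, zero_mem _⟩ : ran P) = 0 := rfl
    rw [this]; simp⟩

theorem BC.add {P : Matrix ι ι ℂ} {Θ : ran P →ₗ[ℂ] ran P} {r t r' t' : EuclideanSpace ℂ ι}
    (h : BC P Θ r t) (h' : BC P Θ r' t') : BC P Θ (r + r') (t + t') := by
  obtain ⟨h, e⟩ := h
  obtain ⟨h', e'⟩ := h'
  refine ⟨add_mem h h', ?_⟩
  have : (⟨r + r', add_mem h h'⟩ : ran P) = ⟨r, h⟩ + ⟨r', h'⟩ := rfl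
  rw [this, map_add, map_add, e, e']; rfl

theorem BC.smul {P : Matrix ι ι ℂ} {Θ : ran P →ₗ[ℂ] ran P} {r t : EuclideanSpace ℂ ι} (c : ℂ)
    (h : BC P Θ r t) : BC P Θ (c • r) (c • t) := by
  obtain ⟨h, e⟩ := h
  refine ⟨Submodule.smul_mem _ c h, ?_⟩
  have : (⟨c • r, Submodule.smul_mem _ c h⟩ : ran P) = c • ⟨r, h⟩ := rfl
  rw [this, map_smul, map_smul, e]; rfl

/-- `Θ : ran P → ran P` is symmetric. -/
abbrev IsSymmetricOp (P : Matrix ι ι ℂ) (Θ : ran P →ₗ[ℂ] ran P) : Prop :=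
  LinearMap.IsSymmetric (𝕜 := ℂ) (E := ran P) Θ

/-- The matrix `P Θ P` on the whole space, where the right `P` is the surjection onto `ran P` and
the left one the inclusion of `ran P`. -/
def extendOp (P : Matrix ι ι ℂ) (Θ : ran P →ₗ[ℂ] ran P) : Matrix ι ι ℂ :=
  Matrix.toEuclideanLin.symm
    ((ran P).subtype ∘ₗ Θ ∘ₗ (Matrix.toEuclideanLin P).rangeRestrict)

/-- The operator `P B : ran P → ran P`; it is the restriction of `B` if `P` is an orthogonal
projector and `B` maps `ran P` into itself. -/
def compress (P B : Matrix ι ι ℂ) : ran P →ₗ[ℂ] ran P :=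
  (Matrix.toEuclideanLin P).rangeRestrict ∘ₗ Matrix.toEuclideanLin B ∘ₗ (ran P).subtype

/-- The matrix of the orthogonal projector onto a subspace. -/
def projOnto (K : Submodule ℂ (EuclideanSpace ℂ ι)) : Matrix ι ι ℂ :=
  Matrix.toEuclideanLin.symm (K.starProjection : EuclideanSpace ℂ ι →ₗ[ℂ] EuclideanSpace ℂ ι)

/-- `A ⊕ A`. -/
def double (A : Matrix ι ι ℂ) : Matrix (ι ⊕ ι) (ι ⊕ ι) ℂ := Matrix.fromBlocks A 0 0 A

end Param

section OperatorFacts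

variable {n : ℕ} {y : Fin n → ℝ} {f g : L2}

theorem tau_zero : tau y 0 = 0 := by ext s; simp [tau, tauAt, mean_zero]

theorem rho_zero : rho y 0 = 0 := by ext s; simp [rho, rhoAt, jump_zero]

theorem tau_add (hf : f ∈ H1 y) (hg : g ∈ H1 y) : tau y (f + g) = tau y f + tau y g := by
  ext s; simp [tau, tauAt, mean_add hf hg]

theorem rho_add (hf : f ∈ H1 y) (hg : g ∈ H1 y) : rho y (f + g) = rho y f + rho y g := by
  ext s; simp only [rho, rhoAt, jump_add hf hg, map_add, smul_add]; rfl

theorem tau_smul (c : ℂ) (hf : f ∈ H1 y) : tau y (c • f) = c • tau y f := by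
  ext s; simp [tau, tauAt, mean_smul c hf]

theorem rho_smul (c : ℂ) (hf : f ∈ H1 y) : rho y (c • f) = c • rho y f := by
  ext s; simp only [rho, rhoAt, jump_smul c hf, map_smul, smul_comm _ c]; rfl

theorem tauHat_zero : tauHat y 0 = 0 := by
  ext (⟨i, k⟩ | ⟨i, k⟩) <;> fin_cases i <;> simp [tauHat, tauHatComp, mean_zero, wderiv_zero]

theorem rhoHat_zero : rhoHat y 0 = 0 := by
  ext (⟨i, k⟩ | ⟨i, k⟩) <;> fin_cases i <;> simp [rhoHat, rhoHatComp, jump_zero, wderiv_zero]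

theorem tauHat_add (hf : f ∈ H2 y) (hg : g ∈ H2 y) :
    tauHat y (f + g) = tauHat y f + tauHat y g := by
  ext (⟨i, k⟩ | ⟨i, k⟩) <;> fin_cases i <;>
    simp [tauHat, tauHatComp, wderiv_add hf.1 hg.1, mean_add hf.1 hg.1, mean_add hf.2 hg.2]

theorem rhoHat_add (hf : f ∈ H2 y) (hg : g ∈ H2 y) :
    rhoHat y (f + g) = rhoHat y f + rhoHat y g := by
  ext (⟨i, k⟩ | ⟨i, k⟩) <;> fin_cases i <;>
    simp [rhoHat, rhoHatComp, wderiv_add hf.1 hg.1, jump_add hf.1 hg.1, jump_add hf.2 hg.2,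
      add_comm]

theorem tauHat_smul (c : ℂ) (hf : f ∈ H2 y) : tauHat y (c • f) = c • tauHat y f := by
  ext (⟨i, k⟩ | ⟨i, k⟩) <;> fin_cases i <;>
    simp [tauHat, tauHatComp, wderiv_smul c hf.1, mean_smul c hf.1, mean_smul c hf.2]

theorem rhoHat_smul (c : ℂ) (hf : f ∈ H2 y) : rhoHat y (c • f) = c • rhoHat y f := by
  ext (⟨i, k⟩ | ⟨i, k⟩) <;> fin_cases i <;>
    simp [rhoHat, rhoHatComp, wderiv_smul c hf.1, jump_smul c hf.1, jump_smul c hf.2]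

end OperatorFacts

/-- The Dirac operator `D_{Π,Θ}` in `L²(ℝ; ℂ²)`: the domain is the set of all
`Ψ ∈ H¹(ℝ \ {y₁, …, yₙ}; ℂ²)` with `ρΨ ∈ ran Π` and `Π τΨ = Θ ρΨ`, and there
`D_{Π,Θ} Ψ = -i σ₁ Ψ' + (1/2) σ₃ Ψ`. -/
def diracOp {n : ℕ} (y : Fin n → ℝ) (P : Matrix (Fin 2 × Fin n) (Fin 2 × Fin n) ℂ)
    (Θ : ran P →ₗ[ℂ] ran P) : L2 →ₗ.[ℂ] L2 where
  domain :=
    { carrier := {Ψ | Ψ ∈ H1 y ∧ BC P Θ (rho y Ψ) (tau y Ψ)}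
      zero_mem' := ⟨zero_mem _, by rw [rho_zero, tau_zero]; exact BC.zero P Θ⟩
      add_mem' := fun ⟨h, b⟩ ⟨h', b'⟩ =>
        ⟨add_mem h h', by rw [rho_add h h', tau_add h h']; exact b.add b'⟩
      smul_mem' := fun c _ ⟨h, b⟩ =>
        ⟨Submodule.smul_mem _ c h, by rw [rho_smul c h, tau_smul c h]; exact b.smul c⟩ }
  toFun :=
    { toFun := fun Ψ => (-Complex.I) • act sigma1 (wderiv y Ψ) + (1 / 2 : ℂ) • act sigma3 Ψ
      map_add' := fun Ψ Φ => by
        rw [Submodule.coe_add, wderiv_add Ψ.2.1 Φ.2.1, map_add, map_add]; module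
      map_smul' := fun c Ψ => by
        rw [Submodule.coe_smul, wderiv_smul c Ψ.2.1, map_smul, map_smul, RingHom.id_apply]
        module }

/-- The Schrödinger operator `Ĥ_{Π̂,Θ̂}` in `L²(ℝ; ℂ²)`: the domain is the set of all
`Ψ ∈ H²(ℝ \ {y₁, …, yₙ}; ℂ²)` with `(ρ̂𝟙)Ψ ∈ ran Π̂` and `Π̂ (τ̂𝟙)Ψ = Θ̂ (ρ̂𝟙)Ψ`, and there
`Ĥ_{Π̂,Θ̂} Ψ = -Ψ''`. -/
def schrodingerOp {n : ℕ} (y : Fin n → ℝ)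
    (P : Matrix ((Fin 2 × Fin n) ⊕ (Fin 2 × Fin n)) ((Fin 2 × Fin n) ⊕ (Fin 2 × Fin n)) ℂ)
    (Θ : ran P →ₗ[ℂ] ran P) : L2 →ₗ.[ℂ] L2 where
  domain :=
    { carrier := {Ψ | Ψ ∈ H2 y ∧ BC P Θ (rhoHat y Ψ) (tauHat y Ψ)}
      zero_mem' := ⟨zero_mem _, by rw [rhoHat_zero, tauHat_zero]; exact BC.zero P Θ⟩
      add_mem' := fun ⟨h, b⟩ ⟨h', b'⟩ =>
        ⟨add_mem h h', by rw [rhoHat_add h h', tauHat_add h h']; exact b.add b'⟩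
      smul_mem' := fun c _ ⟨h, b⟩ =>
        ⟨Submodule.smul_mem _ c h, by rw [rhoHat_smul c h, tauHat_smul c h]; exact b.smul c⟩ }
  toFun :=
    { toFun := fun Ψ => -wderiv y (wderiv y Ψ)
      map_add' := fun Ψ Φ => by
        rw [Submodule.coe_add, wderiv_add Ψ.2.1.1 Φ.2.1.1, wderiv_add Ψ.2.1.2 Φ.2.1.2, neg_add]
      map_smul' := fun c Ψ => by
        rw [Submodule.coe_smul, wderiv_smul c Ψ.2.1.1, wderiv_smul c Ψ.2.1.2, RingHom.id_apply,
          smul_neg] }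

/-- The square of an unbounded operator `T`, on the set of all `Ψ ∈ dom T` with
`T Ψ ∈ dom T`. -/
def square {E : Type*} [AddCommGroup E] [Module ℂ E] (T : E →ₗ.[ℂ] E) : E →ₗ.[ℂ] E where
  domain :=
    { carrier := {Ψ | ∃ h : Ψ ∈ T.domain, T ⟨Ψ, h⟩ ∈ T.domain}
      zero_mem' := ⟨zero_mem _, by
        have : (⟨0, zero_mem _⟩ : T.domain) = 0 := rfl
        rw [this, LinearPMap.map_zero]; exact zero_mem _⟩
      add_mem' := fun {Ψ Φ} ⟨h, b⟩ ⟨h', b'⟩ => ⟨add_mem h h', by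
        have : (⟨Ψ + Φ, add_mem h h'⟩ : T.domain) = ⟨Ψ, h⟩ + ⟨Φ, h'⟩ := rfl
        rw [this, LinearPMap.map_add]; exact add_mem b b'⟩
      smul_mem' := fun c Ψ ⟨h, b⟩ => ⟨Submodule.smul_mem _ c h, by
        have : (⟨c • Ψ, Submodule.smul_mem _ c h⟩ : T.domain) = c • ⟨Ψ, h⟩ := rfl
        rw [this, LinearPMap.map_smul]; exact Submodule.smul_mem _ c b⟩ }
  toFun :=
    { toFun := fun Ψ => T ⟨T ⟨Ψ, Ψ.2.choose⟩, Ψ.2.choose_spec⟩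
      map_add' := fun Ψ Φ => (congrArg T (Subtype.ext
        (LinearPMap.map_add T ⟨Ψ, Ψ.2.choose⟩ ⟨Φ, Φ.2.choose⟩))).trans (LinearPMap.map_add T _ _)
      map_smul' := fun c Ψ => (congrArg T (Subtype.ext
        (LinearPMap.map_smul T c ⟨Ψ, Ψ.2.choose⟩))).trans (LinearPMap.map_smul T c _) }

/-- The unitary `U : ℂ²ⁿ ⊕ ℂ²ⁿ → (ℂ² ⊕ ℂ²)ⁿ`,
`(ξ₁, …, ξ₂ₙ) ↦ ((ξ₁, ξₙ₊₁), …, (ξₙ, ξ₂ₙ))`. -/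
def permU (n : ℕ) :
    Matrix ((Fin 2 ⊕ Fin 2) × Fin n) ((Fin 2 × Fin n) ⊕ (Fin 2 × Fin n)) ℂ :=
  Matrix.of fun r s => if Equiv.sumProdDistrib (Fin 2) (Fin 2) (Fin n) r = s then 1 else 0

/-- The `4 × 4` matrix `M₁`. -/
def M1 : Matrix (Fin 2 ⊕ Fin 2) (Fin 2 ⊕ Fin 2) ℂ :=
  Matrix.fromBlocks
    !![1, 0; 0, Complex.I / 2] !![0, 0; 0, Complex.I]
    !![0, 1; -Complex.I / 2, 0] !![0, 0; Complex.I, 0]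

/-- The `4 × 4` matrix `M₂`. -/
def M2 : Matrix (Fin 2 ⊕ Fin 2) (Fin 2 ⊕ Fin 2) ℂ :=
  Matrix.fromBlocks
    !![1 / 2, 0; 0, Complex.I] !![1, 0; 0, 0]
    !![0, -1 / 2; Complex.I, 0] !![0, 1; 0, 0]

/-- `M ⊕ … ⊕ M` (`n` summands). -/
def copies (n : ℕ) (M : Matrix (Fin 2 ⊕ Fin 2) (Fin 2 ⊕ Fin 2) ℂ) :
    Matrix ((Fin 2 ⊕ Fin 2) × Fin n) ((Fin 2 ⊕ Fin 2) × Fin n) ℂ :=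
  Matrix.blockDiagonal fun _ => M

section Hat

variable {n : ℕ}

/-- `Π̂`: the orthogonal projector onto `ran (U* M₂^⊕ U (Π ⊕ Π))`. -/
def hatProj (P : Matrix (Fin 2 × Fin n) (Fin 2 × Fin n) ℂ) :
    Matrix ((Fin 2 × Fin n) ⊕ (Fin 2 × Fin n)) ((Fin 2 × Fin n) ⊕ (Fin 2 × Fin n)) ℂ :=
  projOnto (ran ((permU n)ᴴ * copies n M2 * permU n * double P))

/-- `U* M₂^⊕ U (Π ⊕ Π) U* (M₁^⊕)⁻¹ U`. -/
def hatA (P : Matrix (Fin 2 × Fin n) (Fin 2 × Fin n) ℂ) :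
    Matrix ((Fin 2 × Fin n) ⊕ (Fin 2 × Fin n)) ((Fin 2 × Fin n) ⊕ (Fin 2 × Fin n)) ℂ :=
  (permU n)ᴴ * copies n M2 * permU n * double P * (permU n)ᴴ * (copies n M1)⁻¹ * permU n

/-- `U* M₂^⊕ U (Θ ⊕ Θ) U* (M₂^⊕)⁻¹ U`. -/
def hatB (P : Matrix (Fin 2 × Fin n) (Fin 2 × Fin n) ℂ) (Θ : ran P →ₗ[ℂ] ran P) :
    Matrix ((Fin 2 × Fin n) ⊕ (Fin 2 × Fin n)) ((Fin 2 × Fin n) ⊕ (Fin 2 × Fin n)) ℂ :=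
  (permU n)ᴴ * copies n M2 * permU n * double (extendOp P Θ) *
    (permU n)ᴴ * (copies n M2)⁻¹ * permU n

/-- `Θ̂ : ran Π̂ → ran Π̂`, the operator
`(U* M₂^⊕ U (Π ⊕ Π) U* (M₁^⊕)⁻¹ U)⁻¹ U* M₂^⊕ U (Θ ⊕ Θ) U* (M₂^⊕)⁻¹ U`, where the first
factor is the inverse of an operator in `ran Π̂`. -/
def hatOp (P : Matrix (Fin 2 × Fin n) (Fin 2 × Fin n) ℂ) (Θ : ran P →ₗ[ℂ] ran P) :
    ran (hatProj P) →ₗ[ℂ] ran (hatProj P) :=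
  Ring.inverse (compress (hatProj P) (hatA P) : Module.End ℂ (ran (hatProj P))) ∘ₗ
    compress (hatProj P) (hatB P Θ)

/-- `Θ₁ ⊕ … ⊕ Θₙ` as an operator in the range of `Π₁ ⊕ … ⊕ Πₙ`. -/
def directSumOp {κ : Type*} [Fintype κ] [DecidableEq κ] (P : Fin n → Matrix κ κ ℂ)
    (Θ : ∀ k, ran (P k) →ₗ[ℂ] ran (P k)) :
    ran (Matrix.blockDiagonal P) →ₗ[ℂ] ran (Matrix.blockDiagonal P) :=
  compress (Matrix.blockDiagonal P) (Matrix.blockDiagonal fun k => extendOp (P k) (Θ k))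

/-- `Π̂_k`: the orthogonal projector in `ℂ⁴` onto `ran (M₂ (Π_k ⊕ Π_k) M₁⁻¹)`. -/
def locProj (P : Matrix (Fin 2) (Fin 2) ℂ) : Matrix (Fin 2 ⊕ Fin 2) (Fin 2 ⊕ Fin 2) ℂ :=
  projOnto (ran (M2 * double P * M1⁻¹))

/-- `Θ̂_k : ran Π̂_k → ran Π̂_k`, the operator `Π̂_k M₁ (Θ_k ⊕ Θ_k) M₂⁻¹` in `ran Π̂_k`. -/
def locOp (P : Matrix (Fin 2) (Fin 2) ℂ) (Θ : ran P →ₗ[ℂ] ran P) :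
    ran (locProj P) →ₗ[ℂ] ran (locProj P) :=
  compress (locProj P) (M1 * double (extendOp P Θ) * M2⁻¹)

end Hat

end DiracPoint
end

open DiracPoint

/-!
The boundary data of `Ψ ∈ H²` for the Laplacian are linear images of the boundary data of `Ψ` and
of `D Ψ` for the Dirac expression `D Ψ = -i σ₁ Ψ' + (1/2) σ₃ Ψ`: at every point,
`ρ̂ Ψ = M₂ (ρ Ψ ⊕ ρ D Ψ)` and `τ̂ Ψ = M₁ (τ Ψ ⊕ τ D Ψ)` (`rhoHat_eq`, `tauHat_eq`). For
`Ψ ∈ H¹`, moreover, `D Ψ` is in `H¹` exactly if `Ψ` is in `H²`, and then `D D Ψ = -Ψ'' + Ψ / 4`,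
since `σ₁` and `σ₃` anticommute. So `Ψ` is in the domain of `D²` iff it is in `H²` and both pairs
`(ρ Ψ, τ Ψ)` and `(ρ D Ψ, τ D Ψ)` satisfy the boundary condition of `(Π, Θ)`. What has to be shown
is that this is the boundary condition of `(Π̂, Θ̂)` on `(ρ̂ Ψ, τ̂ Ψ)`.

The reason is the identity `M₂* M₁ = S`, where `S` exchanges the two summands
(`M2_conjTranspose_mul_M1`). It gives `M₁⁻¹ = S M₂*` and `M₂⁻¹ = S M₁*`, and as `S` commutes with
every `X ⊕ X`, the matrices `A = M₂ (Π ⊕ Π) M₁⁻¹` and `C = M₁ (Θ ⊕ Θ) M₂⁻¹` are Hermitian. Hence `A`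
is bijective on its range `ran Π̂ = ran (M₂ (Π ⊕ Π))` and vanishes on the orthogonal complement, so
`A Π̂ = A`. From `A C = M₂ (Θ ⊕ Θ) M₂⁻¹` it follows that `Θ̂` is the compression of `C` to
`ran Π̂` (`inverse_compress_comp`), which is symmetric. Applying `A` to the equation
`Π̂ τ̂ = Θ̂ ρ̂` turns it into `M₂ (Π ⊕ Π) (τ ⊕ τ D) = M₂ (Θ ⊕ Θ) (ρ ⊕ ρ D)` (`BC_pairing_iff`).

This argument works for any pair `N₁, N₂` with `N₂* N₁ = S`, and so for `M₁, M₂` and for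
`U* M₁^⊕ U, U* M₂^⊕ U` alike. For local couples all these matrices are conjugate by `U` to direct
sums, and everything decouples (`hatProj_blockDiagonal`,
`extendOp_hatOp_blockDiagonal`, `BC_conjU_iff`).
-/

namespace DiracPoint

open Matrix (toEuclideanLin)

/-! ### Matrices and operators in the range of an orthogonal projector -/

section Range

variable {ι : Type*} [Fintype ι] [DecidableEq ι]

theorem toEuclideanLin_mul_apply (A B : Matrix ι ι ℂ) (v : EuclideanSpace ℂ ι) :
    toEuclideanLin (A * B) v = toEuclideanLin A (toEuclideanLin B v) := by
  rw [Matrix.toEuclideanLin, Matrix.toLpLin_mul_same, LinearMap.comp_apply]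

theorem toEuclideanLin_one_apply (v : EuclideanSpace ℂ ι) :
    toEuclideanLin (1 : Matrix ι ι ℂ) v = v := by
  rw [Matrix.toEuclideanLin, Matrix.toLpLin_one, LinearMap.id_apply]

theorem ext_toEuclideanLin {A B : Matrix ι ι ℂ}
    (h : ∀ v, toEuclideanLin A v = toEuclideanLin B v) : A = B :=
  toEuclideanLin.injective (LinearMap.ext h)

theorem ran_le_iff {A B : Matrix ι ι ℂ} : ran A ≤ ran B ↔ ∃ Z, A = B * Z := by
  constructor
  · intro h
    obtain ⟨f, hf⟩ := Module.projective_lifting_property (toEuclideanLin B).rangeRestrict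
      ((toEuclideanLin A).codRestrict (ran B) fun v => h (LinearMap.mem_range_self _ v))
      (LinearMap.surjective_rangeRestrict _)
    refine ⟨toEuclideanLin.symm f, ext_toEuclideanLin fun v => ?_⟩
    rw [toEuclideanLin_mul_apply, LinearEquiv.apply_symm_apply]
    exact (congrArg Subtype.val (LinearMap.congr_fun hf v)).symm
  · rintro ⟨Z, rfl⟩ _ ⟨v, rfl⟩
    exact ⟨toEuclideanLin Z v, (toEuclideanLin_mul_apply _ _ _).symm⟩

theorem ran_mul_eq {B Z W : Matrix ι ι ℂ} (h : Z * W = 1) : ran (B * Z) = ran B :=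
  le_antisymm (ran_le_iff.2 ⟨Z, rfl⟩) (ran_le_iff.2 ⟨W, by rw [mul_assoc, h, mul_one]⟩)

theorem mem_ran_iff {P : Matrix ι ι ℂ} (hP : IsStarProjection P) {v : EuclideanSpace ℂ ι} :
    v ∈ ran P ↔ toEuclideanLin P v = v := by
  refine ⟨?_, fun h => ⟨v, h⟩⟩
  rintro ⟨w, rfl⟩
  rw [← toEuclideanLin_mul_apply, hP.isIdempotentElem.eq]

omit [DecidableEq ι] in
theorem conjTranspose_eq {P : Matrix ι ι ℂ} (hP : IsStarProjection P) : Pᴴ = P :=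
  hP.isSelfAdjoint.star_eq

theorem ran_projOnto (K : Submodule ℂ (EuclideanSpace ℂ ι)) : ran (projOnto K) = K := by
  rw [ran, projOnto, LinearEquiv.apply_symm_apply]
  exact K.range_starProjection

theorem isStarProjection_projOnto (K : Submodule ℂ (EuclideanSpace ℂ ι)) :
    IsStarProjection (projOnto K) := by
  constructor
  · refine ext_toEuclideanLin fun v => ?_
    rw [toEuclideanLin_mul_apply, projOnto, LinearEquiv.apply_symm_apply]
    exact DFunLike.congr_fun (K.isIdempotentElem_starProjection).eq v
  · refine Matrix.isSymmetric_toEuclideanLin_iff.1 ?_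
    rw [projOnto, LinearEquiv.apply_symm_apply]
    exact K.starProjection_isSymmetric

theorem projOnto_mul (A : Matrix ι ι ℂ) : projOnto (ran A) * A = A :=
  ext_toEuclideanLin fun v => by
    rw [toEuclideanLin_mul_apply, ← mem_ran_iff (isStarProjection_projOnto _), ran_projOnto]
    exact LinearMap.mem_range_self _ v

/-- An orthogonal projector is determined by its range. -/
theorem eq_of_ran_eq {P Q : Matrix ι ι ℂ} (hP : IsStarProjection P) (hQ : IsStarProjection Q)
    (h : ran P = ran Q) : P = Q := by
  have key : ∀ {P Q : Matrix ι ι ℂ}, IsStarProjection P → ran P ≤ ran Q → IsStarProjection Q →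
      Q * P = P := by
    intro P Q _ h hQ
    obtain ⟨Z, rfl⟩ := ran_le_iff.1 h
    rw [← mul_assoc, hQ.isIdempotentElem.eq]
  have h1 := congrArg Matrix.conjTranspose (key hP h.le hQ)
  rw [Matrix.conjTranspose_mul, conjTranspose_eq hP, conjTranspose_eq hQ] at h1
  rw [← h1, key hQ h.ge hP]

theorem extendOp_apply (P : Matrix ι ι ℂ) (Θ : ran P →ₗ[ℂ] ran P) (v : EuclideanSpace ℂ ι) :
    toEuclideanLin (extendOp P Θ) v
      = Θ ⟨toEuclideanLin P v, LinearMap.mem_range_self _ v⟩ := by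
  rw [extendOp, LinearEquiv.apply_symm_apply]; rfl

theorem extendOp_apply_coe {P : Matrix ι ι ℂ} (hP : IsStarProjection P) (Θ : ran P →ₗ[ℂ] ran P)
    (v : ran P) : toEuclideanLin (extendOp P Θ) v = Θ v := by
  rw [extendOp_apply]
  congr 2
  exact Subtype.ext ((mem_ran_iff hP).1 v.2)

theorem compress_apply (P B : Matrix ι ι ℂ) (v : ran P) :
    (compress P B v : EuclideanSpace ℂ ι) = toEuclideanLin P (toEuclideanLin B v) := rfl

theorem extendOp_compress (P B : Matrix ι ι ℂ) : extendOp P (compress P B) = P * B * P :=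
  ext_toEuclideanLin fun v => by
    rw [extendOp_apply, compress_apply, toEuclideanLin_mul_apply, toEuclideanLin_mul_apply]

theorem mul_extendOp {P : Matrix ι ι ℂ} (hP : IsStarProjection P) (Θ : ran P →ₗ[ℂ] ran P) :
    P * extendOp P Θ = extendOp P Θ :=
  ext_toEuclideanLin fun v => by
    rw [toEuclideanLin_mul_apply, extendOp_apply, (mem_ran_iff hP).1 (Subtype.prop _)]

theorem extendOp_mul {P : Matrix ι ι ℂ} (hP : IsStarProjection P) (Θ : ran P →ₗ[ℂ] ran P) :
    extendOp P Θ * P = extendOp P Θ :=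
  ext_toEuclideanLin fun v => by
    rw [toEuclideanLin_mul_apply, extendOp_apply_coe hP Θ ⟨_, LinearMap.mem_range_self _ v⟩,
      extendOp_apply]

theorem isSymmetricOp_iff {P : Matrix ι ι ℂ} (hP : IsStarProjection P) (Θ : ran P →ₗ[ℂ] ran P) :
    IsSymmetricOp P Θ ↔ (extendOp P Θ).IsHermitian := by
  rw [← Matrix.isSymmetric_toEuclideanLin_iff]
  constructor
  · intro h v w
    have hPs := Matrix.isSymmetric_toEuclideanLin_iff.2 hP.isSelfAdjoint
    have e : ∀ v, toEuclideanLin P (toEuclideanLin (extendOp P Θ) v)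
        = toEuclideanLin (extendOp P Θ) v := fun v => by
      rw [← toEuclideanLin_mul_apply, mul_extendOp hP]
    rw [← e v, hPs, ← e w, ← hPs v, extendOp_apply, extendOp_apply]
    exact h ⟨_, LinearMap.mem_range_self _ v⟩ ⟨_, LinearMap.mem_range_self _ w⟩
  · intro h v w
    have := h v w
    rw [extendOp_apply_coe hP, extendOp_apply_coe hP] at this
    exact this

/-- The boundary condition in terms of matrices on the whole space. -/
theorem BC_iff {P : Matrix ι ι ℂ} (hP : IsStarProjection P) (Θ : ran P →ₗ[ℂ] ran P)
    (r t : EuclideanSpace ℂ ι) :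
    BC P Θ r t ↔ toEuclideanLin P r = r ∧ toEuclideanLin P t = toEuclideanLin (extendOp P Θ) r := by
  rw [← mem_ran_iff hP]
  constructor
  · rintro ⟨h, e⟩
    exact ⟨h, by rw [e, extendOp_apply_coe hP Θ ⟨r, h⟩]⟩
  · rintro ⟨h, e⟩
    exact ⟨h, by rw [e, extendOp_apply_coe hP Θ ⟨r, h⟩]⟩

/-- The trace of a projector is its rank. -/
theorem finrank_ran {P : Matrix ι ι ℂ} (hP : IsStarProjection P) :
    (Module.finrank ℂ (ran P) : ℂ) = P.trace := by
  have h : LinearMap.IsProj (ran P) (toEuclideanLin P) :=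
    ⟨fun v => LinearMap.mem_range_self _ v, fun v hv => (mem_ran_iff hP).1 hv⟩
  rw [← h.trace, Matrix.toEuclideanLin, Matrix.toLpLin_eq_toLin, Matrix.trace_toLin_eq]

end Range

/-! ### The correspondence between couples for matrices paired by the swap -/

section Pairing

variable {ι : Type*} [Fintype ι] [DecidableEq ι]

/-- The matrix `(u, v) ↦ (v, u)` on `ℂ^ι ⊕ ℂ^ι`. -/
def swapMat (ι : Type*) [DecidableEq ι] : Matrix (ι ⊕ ι) (ι ⊕ ι) ℂ := Matrix.fromBlocks 0 1 1 0

omit [Fintype ι] in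
theorem conjTranspose_swapMat : (swapMat ι)ᴴ = swapMat ι := by
  simp [swapMat, Matrix.fromBlocks_conjTranspose]

theorem swapMat_mul_self : swapMat ι * swapMat ι = 1 := by
  simp [swapMat, Matrix.fromBlocks_multiply]

theorem swapMat_mul_double (A : Matrix ι ι ℂ) : swapMat ι * double A = double A * swapMat ι := by
  simp [swapMat, double, Matrix.fromBlocks_multiply]

omit [DecidableEq ι] in
theorem double_mul (A B : Matrix ι ι ℂ) : double (A * B) = double A * double B := by
  simp [double, Matrix.fromBlocks_multiply]

omit [Fintype ι] [DecidableEq ι] in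
theorem conjTranspose_double (A : Matrix ι ι ℂ) : (double A)ᴴ = double Aᴴ := by
  simp [double, Matrix.fromBlocks_conjTranspose]

omit [Fintype ι] in
theorem double_one : double (1 : Matrix ι ι ℂ) = 1 := by
  simp [double]

omit [Fintype ι] [DecidableEq ι] in
theorem double_smul (c : ℂ) (A : Matrix ι ι ℂ) : double (c • A) = c • double A := by
  simp [double, Matrix.fromBlocks_smul]

/-- The vector `u ⊕ v` of `ℂ^ι ⊕ ℂ^ι`. -/
def append (u v : EuclideanSpace ℂ ι) : EuclideanSpace ℂ (ι ⊕ ι) := WithLp.toLp 2 (Sum.elim u v)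

theorem toEuclideanLin_double_append (A : Matrix ι ι ℂ) (u v : EuclideanSpace ℂ ι) :
    toEuclideanLin (double A) (append u v) = append (toEuclideanLin A u) (toEuclideanLin A v) := by
  ext (i | i) <;> simp [append, double, Matrix.toLpLin_apply, Matrix.fromBlocks_mulVec]

omit [Fintype ι] [DecidableEq ι] in
theorem append_inj {u v u' v' : EuclideanSpace ℂ ι} :
    append u v = append u' v' ↔ u = u' ∧ v = v' := by
  constructor
  · intro h
    exact ⟨by ext i; exact congrArg (fun w : EuclideanSpace ℂ (ι ⊕ ι) => w (Sum.inl i)) h,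
      by ext i; exact congrArg (fun w : EuclideanSpace ℂ (ι ⊕ ι) => w (Sum.inr i)) h⟩
  · rintro ⟨rfl, rfl⟩; rfl

variable {N₁ N₂ : Matrix (ι ⊕ ι) (ι ⊕ ι) ℂ} {P : Matrix ι ι ℂ} {Θ : ran P →ₗ[ℂ] ran P}

/-- The hypothesis `N₂* N₁ = S` is symmetric in `N₁` and `N₂`, as `S` is Hermitian. -/
theorem pairing_symm (h : N₂ᴴ * N₁ = swapMat ι) : N₁ᴴ * N₂ = swapMat ι := by
  have := congrArg Matrix.conjTranspose h
  rwa [Matrix.conjTranspose_mul, Matrix.conjTranspose_conjTranspose, conjTranspose_swapMat] at this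

theorem swapMat_mul_pairing (h : N₂ᴴ * N₁ = swapMat ι) : swapMat ι * N₂ᴴ * N₁ = 1 := by
  rw [mul_assoc, h, swapMat_mul_self]

theorem isUnit_left (h : N₂ᴴ * N₁ = swapMat ι) : IsUnit N₁.det :=
  Matrix.isUnit_det_of_left_inverse (swapMat_mul_pairing h)

theorem isUnit_right (h : N₂ᴴ * N₁ = swapMat ι) : IsUnit N₂.det :=
  isUnit_left (pairing_symm h)

/-- The matrix is `N₂ (X ⊕ X) S N₂*`, and `S` commutes with `X ⊕ X`. -/
theorem isHermitian_pairing_left (h : N₂ᴴ * N₁ = swapMat ι) {X : Matrix ι ι ℂ}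
    (hX : X.IsHermitian) : (N₂ * double X * N₁⁻¹).IsHermitian := by
  rw [Matrix.inv_eq_left_inv (swapMat_mul_pairing h), Matrix.IsHermitian]
  simp only [Matrix.conjTranspose_mul, Matrix.conjTranspose_conjTranspose, conjTranspose_double,
    hX.eq, conjTranspose_swapMat, mul_assoc]
  rw [← mul_assoc (swapMat ι) (double X), swapMat_mul_double, mul_assoc]

theorem isHermitian_pairing_right (h : N₂ᴴ * N₁ = swapMat ι) {X : Matrix ι ι ℂ}
    (hX : X.IsHermitian) : (N₁ * double X * N₂⁻¹).IsHermitian :=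
  isHermitian_pairing_left (pairing_symm h) hX

theorem ran_pairing_left (h : N₂ᴴ * N₁ = swapMat ι) :
    ran (N₂ * double P * N₁⁻¹) = ran (N₂ * double P) :=
  ran_mul_eq (Matrix.nonsing_inv_mul _ (isUnit_left h))

section HermitianRange

variable {A : Matrix ι ι ℂ}

theorem mul_projOnto_of_isHermitian (hA : A.IsHermitian) : A * projOnto (ran A) = A := by
  have := congrArg Matrix.conjTranspose (projOnto_mul A)
  rwa [Matrix.conjTranspose_mul, hA.eq, conjTranspose_eq (isStarProjection_projOnto _)] at this

/-- A Hermitian matrix vanishes only on the orthogonal complement of its range; hence the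
projector onto the range factors through the matrix. -/
theorem exists_projOnto_eq_mul (hA : A.IsHermitian) : ∃ Z, projOnto (ran A) = Z * A := by
  obtain ⟨Z, hZ⟩ := ran_le_iff.1 (ran_projOnto (ran A)).le
  refine ⟨Zᴴ, ?_⟩
  have := congrArg Matrix.conjTranspose hZ
  rwa [Matrix.conjTranspose_mul, hA.eq, conjTranspose_eq (isStarProjection_projOnto _)] at this

theorem isUnit_compress_of_isHermitian (hA : A.IsHermitian) :
    IsUnit (compress (projOnto (ran A)) A : Module.End ℂ (ran (projOnto (ran A)))) := by
  rw [LinearMap.isUnit_iff_ker_eq_bot, LinearMap.ker_eq_bot']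
  intro v hv
  have h1 := congrArg Subtype.val hv
  rw [compress_apply, ← toEuclideanLin_mul_apply, projOnto_mul] at h1
  obtain ⟨Z, hZ⟩ := exists_projOnto_eq_mul hA
  refine Subtype.ext ?_
  rw [← (mem_ran_iff (isStarProjection_projOnto _)).1 v.2]
  nth_rw 1 [hZ]
  rw [toEuclideanLin_mul_apply, h1]
  simp

end HermitianRange

/-- If `A` is Hermitian, then `(A|_{ran A})⁻¹ B`, for `B = A C`, is the compression of `C` to
`ran A`. -/
theorem inverse_compress_comp {A B C Q : Matrix ι ι ℂ} (hA : A.IsHermitian)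
    (hQ : Q = projOnto (ran A)) (hB : A * C = B) :
    Ring.inverse (compress Q A : Module.End ℂ (ran Q)) ∘ₗ compress Q B = compress Q C := by
  subst hQ
  have : compress (projOnto (ran A)) B
      = (compress (projOnto (ran A)) A : Module.End ℂ (ran (projOnto (ran A)))) *
        compress (projOnto (ran A)) C := by
    refine LinearMap.ext fun v => Subtype.ext ?_
    rw [Module.End.mul_apply, compress_apply, compress_apply, compress_apply,
      ← toEuclideanLin_mul_apply A, mul_projOnto_of_isHermitian hA, ← toEuclideanLin_mul_apply A,
      hB]
  rw [this]
  exact Ring.inverse_mul_cancel_left _ _ (isUnit_compress_of_isHermitian hA)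

theorem isSymmetricOp_compress {Q C : Matrix ι ι ℂ} (hQ : IsStarProjection Q)
    (hC : C.IsHermitian) : IsSymmetricOp Q (compress Q C) := by
  rw [isSymmetricOp_iff hQ, extendOp_compress, Matrix.IsHermitian]
  simp only [Matrix.conjTranspose_mul, conjTranspose_eq hQ, hC.eq, mul_assoc]

/-- The identity `A C = B` by which `A⁻¹ B` becomes the compression of the Hermitian matrix
`C`. -/
theorem pairing_mul (h : N₂ᴴ * N₁ = swapMat ι) (hP : IsStarProjection P) :
    N₂ * double P * N₁⁻¹ * (N₁ * double (extendOp P Θ) * N₂⁻¹)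
      = N₂ * double (extendOp P Θ) * N₂⁻¹ := by
  rw [mul_assoc, mul_assoc N₁, Matrix.nonsing_inv_mul_cancel_left _ _ (isUnit_left h), mul_assoc,
    ← mul_assoc (double P), ← double_mul, mul_extendOp hP, mul_assoc]

/-- The boundary condition of the couple attached to `(P, Θ)` on the pair `N₂ (r ⊕ r')`,
`N₁ (t ⊕ t')` says that both `(r, t)` and `(r', t')` satisfy that of `(P, Θ)`. -/
theorem BC_pairing_iff (h : N₂ᴴ * N₁ = swapMat ι) (hP : IsStarProjection P)
    {Q : Matrix (ι ⊕ ι) (ι ⊕ ι) ℂ} (hQ : Q = projOnto (ran (N₂ * double P * N₁⁻¹)))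
    {Ξ : ran Q →ₗ[ℂ] ran Q}
    (hΞ : Ξ = compress Q (N₁ * double (extendOp P Θ) * N₂⁻¹))
    (r r' t t' : EuclideanSpace ℂ ι) :
    BC Q Ξ (toEuclideanLin N₂ (append r r')) (toEuclideanLin N₁ (append t t')) ↔
      BC P Θ r t ∧ BC P Θ r' t' := by
  set A := N₂ * double P * N₁⁻¹ with hA
  have hAh : A.IsHermitian := isHermitian_pairing_left h hP.isSelfAdjoint
  have hQp : IsStarProjection Q := hQ ▸ isStarProjection_projOnto _
  have hAQ : A * Q = A := hQ ▸ mul_projOnto_of_isHermitian hAh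
  have hA1 : A * N₁ = N₂ * double P := by
    rw [hA, Matrix.nonsing_inv_mul_cancel_right _ _ (isUnit_left h)]
  have hX : A * (N₁ * double (extendOp P Θ) * N₂⁻¹) * N₂ = N₂ * double (extendOp P Θ) := by
    rw [hA, pairing_mul h hP, Matrix.nonsing_inv_mul_cancel_right _ _ (isUnit_right h)]
  have hinj : ∀ {v w : EuclideanSpace ℂ (ι ⊕ ι)},
      toEuclideanLin N₂ v = toEuclideanLin N₂ w → v = w := fun {v w} e => by
    have := congrArg (toEuclideanLin N₂⁻¹) e
    rwa [← toEuclideanLin_mul_apply, ← toEuclideanLin_mul_apply,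
      Matrix.nonsing_inv_mul _ (isUnit_right h), toEuclideanLin_one_apply,
      toEuclideanLin_one_apply] at this
  have hdd : double P * double P = double P := by rw [← double_mul, hP.isIdempotentElem.eq]
  have hQN : Q * (N₂ * double P) = N₂ * double P := by
    rw [← hA1, ← mul_assoc, hQ, projOnto_mul]
  have key : BC Q Ξ (toEuclideanLin N₂ (append r r')) (toEuclideanLin N₁ (append t t')) ↔
      toEuclideanLin (double P) (append r r') = append r r' ∧
      toEuclideanLin (double P) (append t t')
        = toEuclideanLin (double (extendOp P Θ)) (append r r') := by
    rw [BC_iff hQp, hΞ, extendOp_compress]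
    simp only [← toEuclideanLin_mul_apply]
    constructor
    · rintro ⟨h1, h2⟩
      refine ⟨?_, hinj ?_⟩
      · have : toEuclideanLin N₂ (append r r') ∈ ran (N₂ * double P) := by
          rw [← ran_pairing_left h, ← ran_projOnto (ran (N₂ * double P * N₁⁻¹)), ← hA, ← hQ,
            mem_ran_iff hQp, ← toEuclideanLin_mul_apply, h1]
        obtain ⟨z, hz⟩ := this
        rw [toEuclideanLin_mul_apply] at hz
        rw [← hinj hz, ← toEuclideanLin_mul_apply, hdd]
      · -- apply `A` to the boundary condition and use `A Q = A`
        rw [← toEuclideanLin_mul_apply, ← toEuclideanLin_mul_apply, ← hA1, ← hX, ← hAQ, mul_assoc A,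
          toEuclideanLin_mul_apply A, h2]
        rw [toEuclideanLin_mul_apply _ N₂, toEuclideanLin_mul_apply _ Q,
          ← toEuclideanLin_mul_apply Q, h1]
        simp only [← toEuclideanLin_mul_apply, ← mul_assoc, hAQ]
    · rintro ⟨h1, h2⟩
      -- `Q = Z A`, so that `Q u = Q v` follows from `A u = A v`
      obtain ⟨Z, hZ⟩ := exists_projOnto_eq_mul hAh
      rw [← hQ] at hZ
      have h3 : toEuclideanLin (Q * N₂) (append r r') = toEuclideanLin N₂ (append r r') := by
        nth_rw 1 [← h1]
        rw [← toEuclideanLin_mul_apply, mul_assoc, hQN, toEuclideanLin_mul_apply, h1]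
      refine ⟨h3, ?_⟩
      rw [mul_assoc _ Q N₂, toEuclideanLin_mul_apply _ (Q * N₂), h3, ← toEuclideanLin_mul_apply]
      rw [hZ, mul_assoc Z, hA1, mul_assoc Z, mul_assoc Z, hX]
      simp only [toEuclideanLin_mul_apply, h2]
  rw [key, BC_iff hP, BC_iff hP]
  simp only [toEuclideanLin_double_append, append_inj]
  tauto

theorem finrank_pairing (h : N₂ᴴ * N₁ = swapMat ι) (hP : IsStarProjection P) :
    Module.finrank ℂ (ran (projOnto (ran (N₂ * double P * N₁⁻¹))))
      = 2 * Module.finrank ℂ (ran P) := by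
  have hd : IsStarProjection (double P) :=
    ⟨by rw [IsIdempotentElem, ← double_mul, hP.isIdempotentElem.eq],
      (conjTranspose_double P).trans (by rw [conjTranspose_eq hP])⟩
  have h1 : Module.finrank ℂ (ran (double P)) = 2 * Module.finrank ℂ (ran P) := by
    have := finrank_ran hd
    have e : (double P).trace = P.trace + P.trace := by
      simp [double, Matrix.trace, Fintype.sum_sum_type]
    rw [e, ← finrank_ran hP] at this
    rw [two_mul]
    exact_mod_cast this
  rw [ran_projOnto, ran_pairing_left h, ← h1]
  have : ran (N₂ * double P) = (ran (double P)).map (toEuclideanLin N₂) := by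
    rw [ran, Matrix.toEuclideanLin, Matrix.toLpLin_mul_same, LinearMap.range_comp]
  rw [this]
  refine (Submodule.equivMapOfInjective _ (Function.LeftInverse.injective
    (g := toEuclideanLin N₂⁻¹) fun v => ?_) _).finrank_eq.symm
  rw [← toEuclideanLin_mul_apply, Matrix.nonsing_inv_mul _ (isUnit_right h),
    toEuclideanLin_one_apply]

end Pairing

/-! ### Direct sums and the permutation `U` -/

section Blocks

variable {κ : Type*} [Fintype κ] [DecidableEq κ] {n : ℕ}

omit [DecidableEq κ] in
theorem isStarProjection_blockDiagonal {P : Fin n → Matrix κ κ ℂ}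
    (hP : ∀ k, IsStarProjection (P k)) : IsStarProjection (Matrix.blockDiagonal P) := by
  constructor
  · rw [IsIdempotentElem, ← Matrix.blockDiagonal_mul]
    congr 1; funext k; exact (hP k).isIdempotentElem.eq
  · refine (Matrix.blockDiagonal_conjTranspose P).trans ?_
    congr 1; funext k; exact conjTranspose_eq (hP k)

theorem extendOp_directSumOp {P : Fin n → Matrix κ κ ℂ} (hP : ∀ k, IsStarProjection (P k))
    (Θ : ∀ k, ran (P k) →ₗ[ℂ] ran (P k)) :
    extendOp (Matrix.blockDiagonal P) (directSumOp P Θ)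
      = Matrix.blockDiagonal fun k => extendOp (P k) (Θ k) := by
  rw [directSumOp, extendOp_compress, ← Matrix.blockDiagonal_mul, ← Matrix.blockDiagonal_mul]
  congr 1; funext k; rw [mul_extendOp (hP k), extendOp_mul (hP k)]

/-- The `k`-th summand of a vector of `(ℂ^κ)ⁿ`. -/
def slice (v : EuclideanSpace ℂ (κ × Fin n)) (k : Fin n) : EuclideanSpace ℂ κ :=
  WithLp.toLp 2 fun i => v (i, k)

omit [Fintype κ] [DecidableEq κ] in
theorem slice_ext_iff {v w : EuclideanSpace ℂ (κ × Fin n)} :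
    v = w ↔ ∀ k, slice v k = slice w k := by
  constructor
  · rintro rfl k; rfl
  · intro h
    ext ⟨i, k⟩
    exact congrArg (fun u : EuclideanSpace ℂ κ => u i) (h k)

theorem slice_blockDiagonal (M : Fin n → Matrix κ κ ℂ) (v : EuclideanSpace ℂ (κ × Fin n))
    (k : Fin n) :
    slice (toEuclideanLin (Matrix.blockDiagonal M) v) k = toEuclideanLin (M k) (slice v k) := by
  ext i
  simp only [slice, Matrix.toLpLin_apply, Matrix.mulVec, dotProduct, Fintype.sum_prod_type]
  refine Finset.sum_congr rfl fun j _ => ?_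
  simp [Matrix.blockDiagonal_apply]

theorem BC_blockDiagonal_iff {P : Fin n → Matrix κ κ ℂ} (hP : ∀ k, IsStarProjection (P k))
    (Θ : ∀ k, ran (P k) →ₗ[ℂ] ran (P k)) (r t : EuclideanSpace ℂ (κ × Fin n)) :
    BC (Matrix.blockDiagonal P) (directSumOp P Θ) r t ↔
      ∀ k, BC (P k) (Θ k) (slice r k) (slice t k) := by
  rw [BC_iff (isStarProjection_blockDiagonal hP), extendOp_directSumOp hP, slice_ext_iff,
    slice_ext_iff, ← forall_and]
  simp only [slice_blockDiagonal, BC_iff (hP _)]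

theorem isSymmetricOp_directSumOp {P : Fin n → Matrix κ κ ℂ} (hP : ∀ k, IsStarProjection (P k))
    {Θ : ∀ k, ran (P k) →ₗ[ℂ] ran (P k)} (hΘ : ∀ k, IsSymmetricOp (P k) (Θ k)) :
    IsSymmetricOp (Matrix.blockDiagonal P) (directSumOp P Θ) := by
  rw [isSymmetricOp_iff (isStarProjection_blockDiagonal hP), extendOp_directSumOp hP,
    Matrix.IsHermitian, Matrix.blockDiagonal_conjTranspose]
  congr 1; funext k; exact ((isSymmetricOp_iff (hP k) _).1 (hΘ k)).eq

end Blocks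

section Perm

variable {n : ℕ}

/-- The matrix `U* M U`, written as a reindexing of `M`. -/
def conjU (M : Matrix ((Fin 2 ⊕ Fin 2) × Fin n) ((Fin 2 ⊕ Fin 2) × Fin n) ℂ) :
    Matrix ((Fin 2 × Fin n) ⊕ (Fin 2 × Fin n)) ((Fin 2 × Fin n) ⊕ (Fin 2 × Fin n)) ℂ :=
  M.submatrix (Equiv.sumProdDistrib (Fin 2) (Fin 2) (Fin n)).symm
    (Equiv.sumProdDistrib (Fin 2) (Fin 2) (Fin n)).symm

theorem permU_conj (M : Matrix ((Fin 2 ⊕ Fin 2) × Fin n) ((Fin 2 ⊕ Fin 2) × Fin n) ℂ) :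
    (permU n)ᴴ * M * permU n = conjU M := by
  ext r s
  simp [conjU, permU, Matrix.mul_apply, ← Equiv.eq_symm_apply]

theorem conjU_mul (M N : Matrix ((Fin 2 ⊕ Fin 2) × Fin n) ((Fin 2 ⊕ Fin 2) × Fin n) ℂ) :
    conjU (M * N) = conjU M * conjU N :=
  (Matrix.submatrix_mul_equiv _ _ _ _ _).symm

theorem conjTranspose_conjU (M : Matrix ((Fin 2 ⊕ Fin 2) × Fin n) ((Fin 2 ⊕ Fin 2) × Fin n) ℂ) :
    (conjU M)ᴴ = conjU Mᴴ :=
  Matrix.conjTranspose_submatrix _ _ _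

theorem conjU_inv (M : Matrix ((Fin 2 ⊕ Fin 2) × Fin n) ((Fin 2 ⊕ Fin 2) × Fin n) ℂ) :
    conjU M⁻¹ = (conjU M)⁻¹ :=
  (Matrix.inv_submatrix_equiv _ _ _).symm

theorem isStarProjection_conjU {M : Matrix ((Fin 2 ⊕ Fin 2) × Fin n) ((Fin 2 ⊕ Fin 2) × Fin n) ℂ}
    (hM : IsStarProjection M) : IsStarProjection (conjU M) :=
  ⟨by rw [IsIdempotentElem, ← conjU_mul, hM.isIdempotentElem.eq],
    (conjTranspose_conjU M).trans (by rw [conjTranspose_eq hM])⟩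

theorem double_blockDiagonal (M : Fin n → Matrix (Fin 2) (Fin 2) ℂ) :
    double (Matrix.blockDiagonal M) = conjU (Matrix.blockDiagonal fun k => double (M k)) := by
  ext (⟨i, k⟩ | ⟨i, k⟩) (⟨j, l⟩ | ⟨j, l⟩) <;>
    simp [double, conjU, Matrix.blockDiagonal_apply]

theorem conjU_copies_swapMat : conjU (copies n (swapMat (Fin 2))) = swapMat (Fin 2 × Fin n) := by
  ext (⟨i, k⟩ | ⟨i, k⟩) (⟨j, l⟩ | ⟨j, l⟩) <;>
    simp [swapMat, copies, conjU, Matrix.blockDiagonal_apply, Matrix.one_apply, ite_and, and_comm]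

/-- The `k`-th vector of `ℂ² ⊕ ℂ²` in the image under `U` of a vector of `ℂ²ⁿ ⊕ ℂ²ⁿ`. -/
def sliceU (v : C4n n) (k : Fin n) : C4 :=
  WithLp.toLp 2 fun i => v (Equiv.sumProdDistrib (Fin 2) (Fin 2) (Fin n) (i, k))

theorem sliceU_ext_iff {v w : C4n n} : v = w ↔ ∀ k, sliceU v k = sliceU w k := by
  constructor
  · rintro rfl k; rfl
  · intro h
    ext (⟨i, k⟩ | ⟨i, k⟩)
    · exact congrArg (fun u : C4 => u (Sum.inl i)) (h k)
    · exact congrArg (fun u : C4 => u (Sum.inr i)) (h k)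

theorem sliceU_append (u v : C2n n) (k : Fin n) :
    sliceU (append u v) k = append (slice u k) (slice v k) := by
  ext (i | i) <;> rfl

theorem sliceU_conjU_blockDiagonal (M : Fin n → Matrix (Fin 2 ⊕ Fin 2) (Fin 2 ⊕ Fin 2) ℂ)
    (v : C4n n) (k : Fin n) :
    sliceU (toEuclideanLin (conjU (Matrix.blockDiagonal M)) v) k
      = toEuclideanLin (M k) (sliceU v k) := by
  ext i
  simp only [sliceU, Matrix.toLpLin_apply, Matrix.mulVec, dotProduct, conjU]
  rw [← (Equiv.sumProdDistrib (Fin 2) (Fin 2) (Fin n)).sum_comp, Fintype.sum_prod_type]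
  refine Finset.sum_congr rfl fun j _ => ?_
  simp only [Matrix.submatrix_apply, Equiv.symm_apply_apply, Matrix.blockDiagonal_apply]
  simp

/-- A boundary condition whose data are conjugate by `U` to direct sums is local. -/
theorem BC_conjU_iff {Q : Fin n → Matrix (Fin 2 ⊕ Fin 2) (Fin 2 ⊕ Fin 2) ℂ}
    (hQ : ∀ k, IsStarProjection (Q k)) (Ξ : ∀ k, ran (Q k) →ₗ[ℂ] ran (Q k))
    {R : Matrix ((Fin 2 × Fin n) ⊕ (Fin 2 × Fin n)) ((Fin 2 × Fin n) ⊕ (Fin 2 × Fin n)) ℂ}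
    {Ω : ran R →ₗ[ℂ] ran R} (hR : R = conjU (Matrix.blockDiagonal Q))
    (hΩ : extendOp R Ω = conjU (Matrix.blockDiagonal fun k => extendOp (Q k) (Ξ k))) (r t : C4n n) :
    BC R Ω r t ↔ ∀ k, BC (Q k) (Ξ k) (sliceU r k) (sliceU t k) := by
  have hRp : IsStarProjection R :=
    hR ▸ isStarProjection_conjU (isStarProjection_blockDiagonal hQ)
  rw [BC_iff hRp, hΩ, hR, sliceU_ext_iff, sliceU_ext_iff, ← forall_and]
  simp only [sliceU_conjU_blockDiagonal, BC_iff (hQ _)]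

end Perm

/-! ### The matrices `M₁` and `M₂` and the hat couple -/

section HatCouple

variable {n : ℕ}

/-- The matrices `M₁`, `M₂` intertwine the Green form of the Dirac operator, paired between `Ψ` and
`D Ψ`, with that of the Laplacian. -/
theorem M2_conjTranspose_mul_M1 : M2ᴴ * M1 = swapMat (Fin 2) := by
  have h2 : (starRingEnd ℂ) 2 = 2 := map_ofNat _ 2
  ext (i | i) (j | j) <;> fin_cases i <;> fin_cases j <;>
    simp [M1, M2, swapMat, Matrix.mul_apply, Fintype.sum_sum_type, h2] <;>
    ring_nf <;> simp

theorem copies_mul (M N : Matrix (Fin 2 ⊕ Fin 2) (Fin 2 ⊕ Fin 2) ℂ) :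
    copies n (M * N) = copies n M * copies n N :=
  Matrix.blockDiagonal_mul _ _

theorem copies_inv {M : Matrix (Fin 2 ⊕ Fin 2) (Fin 2 ⊕ Fin 2) ℂ} (hM : IsUnit M.det) :
    (copies n M)⁻¹ = copies n M⁻¹ :=
  Matrix.inv_eq_left_inv (by
    rw [← copies_mul, Matrix.nonsing_inv_mul _ hM]; exact Matrix.blockDiagonal_one)

theorem conjU_copies_pairing :
    (conjU (copies n M2))ᴴ * conjU (copies n M1) = swapMat (Fin 2 × Fin n) := by
  rw [conjTranspose_conjU, ← conjU_mul, copies, copies, Matrix.blockDiagonal_conjTranspose,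
    ← Matrix.blockDiagonal_mul, ← conjU_copies_swapMat, copies]
  simp only [M2_conjTranspose_mul_M1]

theorem hatA_eq (P : Matrix (Fin 2 × Fin n) (Fin 2 × Fin n) ℂ) :
    hatA P = conjU (copies n M2) * double P * (conjU (copies n M1))⁻¹ := by
  rw [← conjU_inv, ← permU_conj, ← permU_conj, hatA]
  simp only [Matrix.mul_assoc]

theorem hatB_eq (P : Matrix (Fin 2 × Fin n) (Fin 2 × Fin n) ℂ) (Θ : ran P →ₗ[ℂ] ran P) :
    hatB P Θ = conjU (copies n M2) * double (extendOp P Θ) * (conjU (copies n M2))⁻¹ := by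
  rw [← conjU_inv, ← permU_conj, ← permU_conj, hatB]
  simp only [Matrix.mul_assoc]

/-- `ran Π̂` is defined without the invertible factor `U* (M₁^⊕)⁻¹ U` of `A`. -/
theorem hatProj_eq (P : Matrix (Fin 2 × Fin n) (Fin 2 × Fin n) ℂ) :
    hatProj P = projOnto (ran (hatA P)) := by
  rw [hatProj, permU_conj, hatA_eq, ran_pairing_left conjU_copies_pairing]

theorem isHermitian_hatA {P : Matrix (Fin 2 × Fin n) (Fin 2 × Fin n) ℂ} (hP : IsStarProjection P) :
    (hatA P).IsHermitian := by
  rw [hatA_eq]; exact isHermitian_pairing_left conjU_copies_pairing hP.isSelfAdjoint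

/-- `Θ̂` is the compression of `U* M₁^⊕ U (Θ ⊕ Θ) U* (M₂^⊕)⁻¹ U` to `ran Π̂`. -/
theorem hatOp_eq {P : Matrix (Fin 2 × Fin n) (Fin 2 × Fin n) ℂ} (hP : IsStarProjection P)
    (Θ : ran P →ₗ[ℂ] ran P) :
    hatOp P Θ = compress (hatProj P)
      (conjU (copies n M1) * double (extendOp P Θ) * (conjU (copies n M2))⁻¹) :=
  inverse_compress_comp (isHermitian_hatA hP) (hatProj_eq P) (by
    rw [hatA_eq, hatB_eq, pairing_mul conjU_copies_pairing hP])

theorem isStarProjection_locProj (P : Matrix (Fin 2) (Fin 2) ℂ) : IsStarProjection (locProj P) :=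
  isStarProjection_projOnto _

/-- For a local couple, `A` and `C` are conjugate by `U` to direct sums. -/
theorem conjU_copies_conj_inv {M N : Matrix (Fin 2 ⊕ Fin 2) (Fin 2 ⊕ Fin 2) ℂ}
    (hN : IsUnit N.det) (X : Fin n → Matrix (Fin 2) (Fin 2) ℂ) :
    conjU (copies n M) * double (Matrix.blockDiagonal X) * (conjU (copies n N))⁻¹
      = conjU (Matrix.blockDiagonal fun k => M * double (X k) * N⁻¹) := by
  rw [← conjU_inv, copies_inv hN, double_blockDiagonal, ← conjU_mul, ← conjU_mul, copies, copies,
    ← Matrix.blockDiagonal_mul, ← Matrix.blockDiagonal_mul]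

theorem hatProj_blockDiagonal (P : Fin n → Matrix (Fin 2) (Fin 2) ℂ) :
    hatProj (Matrix.blockDiagonal P)
      = conjU (Matrix.blockDiagonal fun k => locProj (P k)) := by
  refine eq_of_ran_eq (isStarProjection_projOnto _)
    (isStarProjection_conjU (isStarProjection_blockDiagonal fun k => isStarProjection_locProj _)) ?_
  rw [hatProj_eq, ran_projOnto, hatA_eq,
    conjU_copies_conj_inv (isUnit_left M2_conjTranspose_mul_M1)]
  refine le_antisymm (ran_le_iff.2 ⟨conjU (Matrix.blockDiagonal fun k =>
    M2 * double (P k) * M1⁻¹), ?_⟩) ?_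
  · rw [← conjU_mul, ← Matrix.blockDiagonal_mul]
    simp only [locProj, projOnto_mul]
  · choose Z hZ using fun k => ran_le_iff.1 (ran_projOnto (ran (M2 * double (P k) * M1⁻¹))).le
    refine ran_le_iff.2 ⟨conjU (Matrix.blockDiagonal Z), ?_⟩
    rw [← conjU_mul, ← Matrix.blockDiagonal_mul]
    simp only [locProj, ← hZ]

theorem extendOp_hatOp_blockDiagonal {P : Fin n → Matrix (Fin 2) (Fin 2) ℂ}
    (hP : ∀ k, IsStarProjection (P k)) (Θ : ∀ k, ran (P k) →ₗ[ℂ] ran (P k)) :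
    extendOp (hatProj (Matrix.blockDiagonal P)) (hatOp (Matrix.blockDiagonal P) (directSumOp P Θ))
      = conjU (Matrix.blockDiagonal fun k =>
          extendOp (locProj (P k)) (locOp (P k) (Θ k))) := by
  rw [hatOp_eq (isStarProjection_blockDiagonal hP), extendOp_compress, hatProj_blockDiagonal,
    extendOp_directSumOp hP, conjU_copies_conj_inv (isUnit_right M2_conjTranspose_mul_M1),
    ← conjU_mul, ← conjU_mul, ← Matrix.blockDiagonal_mul, ← Matrix.blockDiagonal_mul]
  simp only [locOp, extendOp_compress]

theorem locProj_one : locProj 1 = 1 := by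
  refine eq_of_ran_eq (isStarProjection_projOnto _) (.one _) ?_
  rw [locProj, ran_projOnto, double_one, mul_one]
  refine le_antisymm (ran_le_iff.2 ⟨M2 * M1⁻¹, by rw [one_mul]⟩) (ran_le_iff.2 ⟨M1 * M2⁻¹, ?_⟩)
  rw [mul_assoc, Matrix.nonsing_inv_mul_cancel_left _ _ (isUnit_left M2_conjTranspose_mul_M1),
    Matrix.mul_nonsing_inv _ (isUnit_right M2_conjTranspose_mul_M1)]

/-- A symmetric operator in a subspace of dimension at most one is a real multiple of the
identity. -/
theorem exists_real_smul_of_finrank_le_one {E : Type*} [NormedAddCommGroup E]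
    [InnerProductSpace ℂ E] [FiniteDimensional ℂ E] (hE : Module.finrank ℂ E ≤ 1)
    {T : E →ₗ[ℂ] E} (hT : T.IsSymmetric) : ∃ θ : ℝ, T = (θ : ℂ) • LinearMap.id := by
  obtain ⟨v, hv⟩ := finrank_le_one_iff.1 hE
  obtain ⟨c, hc⟩ := hv (T v)
  by_cases h0 : v = 0
  · refine ⟨0, LinearMap.ext fun w => ?_⟩
    obtain ⟨d, rfl⟩ := hv w
    simp [h0]
  · have hr : (starRingEnd ℂ) c = c := by
      have := hT v v
      rw [← hc, inner_smul_left, inner_smul_right] at this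
      exact mul_right_cancel₀ (inner_self_ne_zero.2 h0) this
    obtain ⟨θ, rfl⟩ := Complex.conj_eq_iff_real.1 hr
    refine ⟨θ, LinearMap.ext fun w => ?_⟩
    obtain ⟨d, rfl⟩ := hv w
    rw [map_smul, ← hc, LinearMap.smul_apply, LinearMap.id_apply, smul_comm]

theorem finrank_ran_lt {ι : Type*} [Fintype ι] [DecidableEq ι] {P : Matrix ι ι ℂ}
    (hP : IsStarProjection P) (h1 : P ≠ 1) : Module.finrank ℂ (ran P) < Fintype.card ι := by
  rw [← finrank_euclideanSpace (𝕜 := ℂ) (ι := ι)]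
  refine Submodule.finrank_lt fun h => h1 (ext_toEuclideanLin fun v => ?_)
  rw [(mem_ran_iff hP).1 (h ▸ Submodule.mem_top), toEuclideanLin_one_apply]

theorem finrank_ran_pos {ι : Type*} [Fintype ι] [DecidableEq ι] {P : Matrix ι ι ℂ}
    (h0 : P ≠ 0) : 0 < Module.finrank ℂ (ran P) := by
  rw [Module.finrank_pos_iff, Submodule.nontrivial_iff_ne_bot]
  exact fun h => h0 (toEuclideanLin.injective ((LinearMap.range_eq_bot.1 h).trans (by simp)))

theorem extendOp_smul_id {ι : Type*} [Fintype ι] [DecidableEq ι] (P : Matrix ι ι ℂ) (c : ℂ) :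
    extendOp P (c • LinearMap.id) = c • P :=
  ext_toEuclideanLin fun v => by rw [extendOp_apply, map_smul]; rfl

theorem compress_smul {ι : Type*} [Fintype ι] [DecidableEq ι] (P B : Matrix ι ι ℂ) (c : ℂ) :
    compress P (c • B) = c • compress P B := by
  refine LinearMap.ext fun v => Subtype.ext ?_
  rw [compress_apply, map_smul, LinearMap.smul_apply, map_smul]; rfl

theorem locOp_smul_id (P : Matrix (Fin 2) (Fin 2) ℂ) (c : ℂ) :
    locOp P (c • LinearMap.id) = c • compress (locProj P) (M1 * double P * M2⁻¹) := by
  rw [locOp, extendOp_smul_id, double_smul, mul_smul_comm, smul_mul_assoc, compress_smul]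

end HatCouple

/-! ### Constant matrices acting on Sobolev functions -/

section Action

variable {n : ℕ} {y : Fin n → ℝ} {f g : L2}

theorem coeFn_act (A : Matrix (Fin 2) (Fin 2) ℂ) (f : L2) :
    act A f =ᵐ[volume] fun x => toEuclideanLin A (f x) :=
  ContinuousLinearMap.coeFn_compLpL (Matrix.toEuclideanCLM (n := Fin 2) (𝕜 := ℂ) A) f

theorem act_mul (A B : Matrix (Fin 2) (Fin 2) ℂ) (f : L2) : act (A * B) f = act A (act B f) := by
  apply Lp.ext
  filter_upwards [coeFn_act (A * B) f, coeFn_act A (act B f), coeFn_act B f] with x h1 h2 h3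
  rw [h1, h2, h3, toEuclideanLin_mul_apply]

theorem act_one (f : L2) : act 1 f = f := by
  apply Lp.ext
  filter_upwards [coeFn_act 1 f] with x h1
  rw [h1, toEuclideanLin_one_apply]

theorem act_neg (A : Matrix (Fin 2) (Fin 2) ℂ) (f : L2) : act (-A) f = -act A f := by
  apply Lp.ext
  filter_upwards [coeFn_act (-A) f, coeFn_act A f, Lp.coeFn_neg (act A f)] with x h1 h2 h3
  rw [h1, h3, Pi.neg_apply, h2, map_neg, LinearMap.neg_apply]

theorem IsWeakDeriv.act (A : Matrix (Fin 2) (Fin 2) ℂ) (h : IsWeakDeriv y f g) :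
    IsWeakDeriv y (act A f) (act A g) := by
  intro φ h1 h2 h3
  have hc := h1.continuous_deriv (n := ∞) (by simp)
  set L := Matrix.toEuclideanCLM (n := Fin 2) (𝕜 := ℂ) A with hL
  have e1 : ∫ x, deriv φ x • (DiracPoint.act A f) x = ∫ x, L (deriv φ x • f x) :=
    integral_congr_ae (by
      filter_upwards [coeFn_act A f] with x hx
      rw [hx, L.map_smul_of_tower]; rfl)
  have e2 : ∫ x, φ x • (DiracPoint.act A g) x = ∫ x, L (φ x • g x) :=
    integral_congr_ae (by
      filter_upwards [coeFn_act A g] with x hx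
      rw [hx, L.map_smul_of_tower]; rfl)
  rw [e1, e2, L.integral_comp_comm
      ((locInt f).integrable_smul_left_of_hasCompactSupport hc h2.deriv),
    L.integral_comp_comm
      ((locInt g).integrable_smul_left_of_hasCompactSupport h1.continuous h2),
    h φ h1 h2 h3, map_neg]

theorem act_mem_H1 (A : Matrix (Fin 2) (Fin 2) ℂ) (hf : f ∈ H1 y) : act A f ∈ H1 y :=
  ⟨_, (wderiv_spec hf).act A⟩

theorem wderiv_act (A : Matrix (Fin 2) (Fin 2) ℂ) (hf : f ∈ H1 y) :
    wderiv y (act A f) = act A (wderiv y f) :=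
  wderiv_eq ((wderiv_spec hf).act A)

theorem leftLim_act (A : Matrix (Fin 2) (Fin 2) ℂ) (hf : f ∈ H1 y) (a : ℝ) :
    leftLim (act A f) a = toEuclideanLin A (leftLim f a) :=
  Tendsto.limUnder_eq ((((Matrix.toEuclideanCLM (n := Fin 2) (𝕜 := ℂ) A).continuous.tendsto _).comp
    (tendsto_leftLim hf a)).congr'
    (((coeFn_act A f).filter_mono inf_le_right).mono fun _ h => h.symm))

theorem rightLim_act (A : Matrix (Fin 2) (Fin 2) ℂ) (hf : f ∈ H1 y) (a : ℝ) :
    rightLim (act A f) a = toEuclideanLin A (rightLim f a) :=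
  Tendsto.limUnder_eq ((((Matrix.toEuclideanCLM (n := Fin 2) (𝕜 := ℂ) A).continuous.tendsto _).comp
    (tendsto_rightLim hf a)).congr'
    (((coeFn_act A f).filter_mono inf_le_right).mono fun _ h => h.symm))

theorem mean_act (A : Matrix (Fin 2) (Fin 2) ℂ) (hf : f ∈ H1 y) (a : ℝ) :
    mean (act A f) a = toEuclideanLin A (mean f a) := by
  rw [mean, leftLim_act A hf, rightLim_act A hf, mean, map_smul, map_add]

theorem jump_act (A : Matrix (Fin 2) (Fin 2) ℂ) (hf : f ∈ H1 y) (a : ℝ) :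
    jump (act A f) a = toEuclideanLin A (jump f a) := by
  rw [jump, leftLim_act A hf, rightLim_act A hf, jump, map_sub]

end Action

/-! ### The Dirac expression and its square -/

section DiracExpression

variable {n : ℕ} {y : Fin n → ℝ} {Ψ : L2}

/-- The function `-i σ₁ Ψ' + (1/2) σ₃ Ψ`, without boundary conditions. -/
noncomputable def diracExpr (y : Fin n → ℝ) (Ψ : L2) : L2 :=
  (-Complex.I) • act sigma1 (wderiv y Ψ) + (1 / 2 : ℂ) • act sigma3 Ψ

theorem sigma1_mul_self : sigma1 * sigma1 = 1 := by
  ext i j; fin_cases i <;> fin_cases j <;> simp [sigma1]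

theorem sigma3_mul_self : sigma3 * sigma3 = 1 := by
  ext i j; fin_cases i <;> fin_cases j <;> simp [sigma3]

theorem sigma3_mul_sigma1 : sigma3 * sigma1 = -(sigma1 * sigma3) := by
  ext i j; fin_cases i <;> fin_cases j <;> simp [sigma1, sigma3]

/-- As `σ₁` is invertible and constant, `D Ψ` is in `H¹` only if `Ψ'` is. -/
theorem diracExpr_mem_H1_iff (h : Ψ ∈ H1 y) : diracExpr y Ψ ∈ H1 y ↔ Ψ ∈ H2 y := by
  have h3 : (1 / 2 : ℂ) • act sigma3 Ψ ∈ H1 y := Submodule.smul_mem _ _ (act_mem_H1 _ h)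
  rw [diracExpr, Submodule.add_mem_iff_left _ h3,
    Submodule.smul_mem_iff _ (neg_ne_zero.2 Complex.I_ne_zero)]
  refine ⟨fun hd => ⟨h, ?_⟩, fun hd => act_mem_H1 _ hd.2⟩
  rw [← act_one (wderiv y Ψ), ← sigma1_mul_self, act_mul]
  exact act_mem_H1 _ hd

/-- The first-order terms cancel, as `σ₁` and `σ₃` anticommute. -/
theorem diracExpr_diracExpr (h : Ψ ∈ H2 y) :
    diracExpr y (diracExpr y Ψ) = (1 / 4 : ℂ) • Ψ + -wderiv y (wderiv y Ψ) := by
  have hw : wderiv y (diracExpr y Ψ) = (-Complex.I) • act sigma1 (wderiv y (wderiv y Ψ)) +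
      (1 / 2 : ℂ) • act sigma3 (wderiv y Ψ) := by
    rw [diracExpr, wderiv_add (Submodule.smul_mem _ _ (act_mem_H1 _ h.2))
      (Submodule.smul_mem _ _ (act_mem_H1 _ h.1)), wderiv_smul _ (act_mem_H1 _ h.2),
      wderiv_smul _ (act_mem_H1 _ h.1), wderiv_act _ h.1, wderiv_act _ h.2]
  rw [diracExpr, hw, diracExpr]
  simp only [map_add, map_smul, ← act_mul, sigma1_mul_self, sigma3_mul_self, act_one,
    sigma3_mul_sigma1, act_neg, smul_add, smul_smul, smul_neg]
  have hI : -Complex.I * -Complex.I = -1 := by simp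
  rw [hI]
  module

theorem mean_diracExpr (h : Ψ ∈ H2 y) (a : ℝ) :
    mean (diracExpr y Ψ) a = (-Complex.I) • toEuclideanLin sigma1 (mean (wderiv y Ψ) a) +
      (1 / 2 : ℂ) • toEuclideanLin sigma3 (mean Ψ a) := by
  rw [diracExpr, mean_add (Submodule.smul_mem _ _ (act_mem_H1 _ h.2))
    (Submodule.smul_mem _ _ (act_mem_H1 _ h.1)), mean_smul _ (act_mem_H1 _ h.2),
    mean_smul _ (act_mem_H1 _ h.1), mean_act _ h.1, mean_act _ h.2]

theorem jump_diracExpr (h : Ψ ∈ H2 y) (a : ℝ) :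
    jump (diracExpr y Ψ) a = (-Complex.I) • toEuclideanLin sigma1 (jump (wderiv y Ψ) a) +
      (1 / 2 : ℂ) • toEuclideanLin sigma3 (jump Ψ a) := by
  rw [diracExpr, jump_add (Submodule.smul_mem _ _ (act_mem_H1 _ h.2))
    (Submodule.smul_mem _ _ (act_mem_H1 _ h.1)), jump_smul _ (act_mem_H1 _ h.2),
    jump_smul _ (act_mem_H1 _ h.1), jump_act _ h.1, jump_act _ h.2]

/-- `τ̂_a Ψ = M₁ (τ_a Ψ ⊕ τ_a D Ψ)`: `⟨Ψ'⟩_a` is recovered from `⟨D Ψ⟩_a` and `⟨Ψ⟩_a`. -/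
theorem tauHatAt_eq (h : Ψ ∈ H2 y) (a : ℝ) :
    tauHatAt y a Ψ = toEuclideanLin M1 (append (tauAt a Ψ) (tauAt a (diracExpr y Ψ))) := by
  simp only [tauAt, mean_diracExpr h]
  ext (i | i) <;> fin_cases i <;>
    simp [tauHatAt, tauHatComp, append, M1, sigma1, sigma3, Matrix.toLpLin_apply, Matrix.mulVec,
      dotProduct, Fintype.sum_sum_type] <;> ring_nf <;> simp

/-- `ρ̂_a Ψ = M₂ (ρ_a Ψ ⊕ ρ_a D Ψ)`: `[Ψ']_a` is recovered from `[D Ψ]_a` and `[Ψ]_a`. -/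
theorem rhoHatAt_eq (h : Ψ ∈ H2 y) (a : ℝ) :
    rhoHatAt y a Ψ = toEuclideanLin M2 (append (rhoAt a Ψ) (rhoAt a (diracExpr y Ψ))) := by
  simp only [rhoAt, jump_diracExpr h]
  ext (i | i) <;> fin_cases i <;>
    simp [rhoHatAt, rhoHatComp, append, M2, sigma1, sigma3, Matrix.toLpLin_apply, Matrix.mulVec,
      dotProduct, Fintype.sum_sum_type] <;> ring_nf <;> simp

theorem sliceU_tauHat (y : Fin n → ℝ) (Ψ : L2) (k : Fin n) :
    sliceU (tauHat y Ψ) k = tauHatAt y (y k) Ψ := by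
  ext (i | i) <;> rfl

theorem sliceU_rhoHat (y : Fin n → ℝ) (Ψ : L2) (k : Fin n) :
    sliceU (rhoHat y Ψ) k = rhoHatAt y (y k) Ψ := by
  ext (i | i) <;> rfl

theorem tauHat_eq (h : Ψ ∈ H2 y) :
    tauHat y Ψ = toEuclideanLin (conjU (copies n M1))
      (append (tau y Ψ) (tau y (diracExpr y Ψ))) := by
  rw [sliceU_ext_iff]
  intro k
  rw [copies, sliceU_conjU_blockDiagonal, sliceU_append]
  exact (sliceU_tauHat y Ψ k).trans (tauHatAt_eq h (y k))

theorem rhoHat_eq (h : Ψ ∈ H2 y) :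
    rhoHat y Ψ = toEuclideanLin (conjU (copies n M2))
      (append (rho y Ψ) (rho y (diracExpr y Ψ))) := by
  rw [sliceU_ext_iff]
  intro k
  rw [copies, sliceU_conjU_blockDiagonal, sliceU_append]
  exact (sliceU_rhoHat y Ψ k).trans (rhoHatAt_eq h (y k))

theorem mem_schrodingerOp_domain_iff {P : Matrix (Fin 2 × Fin n) (Fin 2 × Fin n) ℂ}
    (hP : IsStarProjection P) (Θ : ran P →ₗ[ℂ] ran P) :
    Ψ ∈ (schrodingerOp y (hatProj P) (hatOp P Θ)).domain ↔
      Ψ ∈ H2 y ∧ BC P Θ (rho y Ψ) (tau y Ψ) ∧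
        BC P Θ (rho y (diracExpr y Ψ)) (tau y (diracExpr y Ψ)) := by
  refine and_congr_right fun h => ?_
  rw [rhoHat_eq h, tauHat_eq h]
  exact BC_pairing_iff conjU_copies_pairing hP ((hatProj_eq P).trans (by rw [hatA_eq]))
    (hatOp_eq hP Θ) _ _ _ _

theorem mem_square_diracOp_domain_iff {P : Matrix (Fin 2 × Fin n) (Fin 2 × Fin n) ℂ}
    (Θ : ran P →ₗ[ℂ] ran P) :
    Ψ ∈ (square (diracOp y P Θ)).domain ↔
      Ψ ∈ H2 y ∧ BC P Θ (rho y Ψ) (tau y Ψ) ∧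
        BC P Θ (rho y (diracExpr y Ψ)) (tau y (diracExpr y Ψ)) := by
  constructor
  · rintro ⟨h, h1, h2⟩
    exact ⟨(diracExpr_mem_H1_iff h.1).1 h1, h.2, h2⟩
  · rintro ⟨h, h1, h2⟩
    exact ⟨⟨h.1, h1⟩, (diracExpr_mem_H1_iff h.1).2 h, h2⟩

theorem square_diracOp {P : Matrix (Fin 2 × Fin n) (Fin 2 × Fin n) ℂ}
    (hP : IsStarProjection P) (Θ : ran P →ₗ[ℂ] ran P) :
    square (diracOp y P Θ) = ((1 / 4 : ℂ) • (LinearMap.id : L2 →ₗ[ℂ] L2)) +ᵥ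
      schrodingerOp y (hatProj P) (hatOp P Θ) := by
  refine LinearPMap.ext (Submodule.ext fun Ψ => ?_) fun Ψ h h' => ?_
  · rw [LinearPMap.vadd_domain, mem_schrodingerOp_domain_iff hP, mem_square_diracOp_domain_iff]
  · exact diracExpr_diracExpr ((mem_square_diracOp_domain_iff Θ).1 h).1

end DiracExpression

end DiracPoint

theorem mainTheorem5 (n : ℕ) (y : Fin n → ℝ) (hy : StrictMono y)
    (Pi : Fin n → Matrix (Fin 2) (Fin 2) ℂ) (hPi : ∀ k, IsStarProjection (Pi k))
    (Th : ∀ k, ran (Pi k) →ₗ[ℂ] ran (Pi k)) (hTh : ∀ k, IsSymmetricOp (Pi k) (Th k)) :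
    -- the boundary conditions of the Dirac operator are the local ones
    (∀ Ψ : L2, Ψ ∈ (diracOp y (Matrix.blockDiagonal Pi) (directSumOp Pi Th)).domain ↔
      Ψ ∈ H1 y ∧ ∀ k, BC (Pi k) (Th k) (rhoAt (y k) Ψ) (tauAt (y k) Ψ)) ∧
    -- the couple `(Π̂, Θ̂)` is well defined and admissible
    IsStarProjection (hatProj (Matrix.blockDiagonal Pi)) ∧
    ran (hatA (Matrix.blockDiagonal Pi)) = ran (hatProj (Matrix.blockDiagonal Pi)) ∧
    IsUnit (compress (hatProj (Matrix.blockDiagonal Pi)) (hatA (Matrix.blockDiagonal Pi)) :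
      Module.End ℂ (ran (hatProj (Matrix.blockDiagonal Pi)))) ∧
    IsSymmetricOp (hatProj (Matrix.blockDiagonal Pi)) (hatOp (Matrix.blockDiagonal Pi) (directSumOp Pi Th)) ∧
    -- `D² = Ĥ + 1/4`
    square (diracOp y (Matrix.blockDiagonal Pi) (directSumOp Pi Th)) =
      ((1 / 4 : ℂ) • (LinearMap.id : L2 →ₗ[ℂ] L2)) +ᵥ
        schrodingerOp y (hatProj (Matrix.blockDiagonal Pi)) (hatOp (Matrix.blockDiagonal Pi) (directSumOp Pi Th)) ∧
    -- `Π̂ = U* (Π̂₁ ⊕ … ⊕ Π̂ₙ) U` and `Θ̂ = U* (Θ̂₁ ⊕ … ⊕ Θ̂ₙ) U`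
    hatProj (Matrix.blockDiagonal Pi) = (permU n)ᴴ * Matrix.blockDiagonal (fun k => locProj (Pi k)) * permU n ∧
    extendOp (hatProj (Matrix.blockDiagonal Pi)) (hatOp (Matrix.blockDiagonal Pi) (directSumOp Pi Th)) =
      (permU n)ᴴ *
        Matrix.blockDiagonal (fun k => extendOp (locProj (Pi k)) (locOp (Pi k) (Th k))) *
        permU n ∧
    -- the blocks
    (∀ k,
      IsStarProjection (locProj (Pi k)) ∧
      ran (locProj (Pi k)) = ran (M2 * double (Pi k) * M1⁻¹) ∧
      Module.finrank ℂ (ran (locProj (Pi k))) = 2 * Module.finrank ℂ (ran (Pi k)) ∧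
      IsSymmetricOp (locProj (Pi k)) (locOp (Pi k) (Th k)) ∧
      (Pi k = 1 →
        locProj (Pi k) = 1 ∧
        extendOp (locProj (Pi k)) (locOp (Pi k) (Th k)) =
          M1 * double (extendOp (Pi k) (Th k)) * M2⁻¹) ∧
      (Pi k ≠ 1 →
        (Pi k ≠ 0 → Module.finrank ℂ (ran (locProj (Pi k))) = 2) ∧
        ∃ θ : ℝ, Th k = (θ : ℂ) • LinearMap.id ∧
          locOp (Pi k) (Th k) =
            (θ : ℂ) • compress (locProj (Pi k)) (M1 * double (Pi k) * M2⁻¹))) ∧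
    -- the boundary conditions of the Schrödinger operator are local
    (∀ Ψ : L2, Ψ ∈ (schrodingerOp y (hatProj (Matrix.blockDiagonal Pi)) (hatOp (Matrix.blockDiagonal Pi) (directSumOp Pi Th))).domain ↔
      Ψ ∈ H2 y ∧ ∀ k, BC (locProj (Pi k)) (locOp (Pi k) (Th k))
        (rhoHatAt y (y k) Ψ) (tauHatAt y (y k) Ψ)) := by
  have hP : IsStarProjection (Matrix.blockDiagonal Pi) := isStarProjection_blockDiagonal hPi
  have hloc : ∀ k, IsStarProjection (locProj (Pi k)) := fun k => isStarProjection_locProj _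
  have hX : ∀ k, (extendOp (Pi k) (Th k)).IsHermitian := fun k =>
    (isSymmetricOp_iff (hPi k) _).1 (hTh k)
  have hpair := M2_conjTranspose_mul_M1
  have hfr : ∀ k, Module.finrank ℂ (ran (locProj (Pi k))) = 2 * Module.finrank ℂ (ran (Pi k)) :=
    fun k => finrank_pairing hpair (hPi k)
  refine ⟨fun Ψ => and_congr_right fun _ => BC_blockDiagonal_iff hPi Th _ _,
    isStarProjection_projOnto _, ?_, ?_, ?_, square_diracOp hP _, ?_, ?_,
    fun k => ⟨hloc k, ran_projOnto _, hfr k, ?_, ?_, ?_⟩, fun Ψ => and_congr_right fun _ => ?_⟩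
  · rw [hatProj_eq, ran_projOnto]
  · rw [hatProj_eq]
    exact isUnit_compress_of_isHermitian (isHermitian_hatA hP)
  · rw [hatOp_eq hP]
    exact isSymmetricOp_compress (isStarProjection_projOnto _)
      (isHermitian_pairing_right conjU_copies_pairing
        ((isSymmetricOp_iff hP _).1 (isSymmetricOp_directSumOp hPi hTh)))
  · rw [permU_conj, hatProj_blockDiagonal]
  · rw [permU_conj, extendOp_hatOp_blockDiagonal hPi]
  · exact isSymmetricOp_compress (hloc k) (isHermitian_pairing_right hpair (hX k))
  · intro h1
    have hl : locProj (Pi k) = 1 := by rw [h1, locProj_one]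
    refine ⟨hl, ?_⟩
    rw [locOp, extendOp_compress, hl, one_mul, mul_one]
  · intro h1
    have hlt := finrank_ran_lt (hPi k) h1
    rw [Fintype.card_fin] at hlt
    refine ⟨fun h0 => ?_, ?_⟩
    · have := finrank_ran_pos h0
      rw [hfr k]
      omega
    · obtain ⟨θ, hθ⟩ := exists_real_smul_of_finrank_le_one (Nat.lt_succ_iff.1 hlt) (hTh k)
      exact ⟨θ, hθ, by rw [hθ, locOp_smul_id]⟩
  · have hr : ∀ k, sliceU (rhoHat y Ψ) k = rhoHatAt y (y k) Ψ := fun k => sliceU_rhoHat y Ψ k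
    have ht : ∀ k, sliceU (tauHat y Ψ) k = tauHatAt y (y k) Ψ := fun k => sliceU_tauHat y Ψ k
    rw [BC_conjU_iff hloc (fun k => locOp (Pi k) (Th k)) (hatProj_blockDiagonal Pi)
      (extendOp_hatOp_blockDiagonal hPi Th)]
    simp only [hr, ht]
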